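/- **Definitions.** A *standard $n$-puzzle* ($n\ge 0$) is a two-row matrix with $n+1$ columns whose entries are the numbers $1,\dots,2n+2$, each occurring once; its $n$ *pieces* are the $2\times2$ blocks of consecutive columns. The *reduction* of a piece replaces its labels by $1,2,3,4$ respecting their order, which gives one of the $24$ standard pieces, coded (top row / bottom row) as $A_1,\dots,A_6=\begin{smallmatrix}4&3\\1&2\end{smallmatrix},\ \begin{smallmatrix}3&4\\1&2\end{smallmatrix},\ \begin{smallmatrix}2&4\\1&3\end{smallmatrix},\ \begin{smallmatrix}3&4\\2&1\end{smallmatrix},\ \begin{smallmatrix}4&3\\2&1\end{smallmatrix},\ \begin{smallmatrix}4&2\\3&1\end{smallmatrix}$; $B_1,\dots,B_6=\begin{smallmatrix}4&2\\1&3\end{smallmatrix},\ \begin{smallmatrix}3&2\\1&4\end{smallmatrix},\ \begin{smallmatrix}2&3\\1&4\end{smallmatrix},\ \begin{smallmatrix}3&1\\2&4\end{smallmatrix},\ \begin{smallmatrix}4&1\\2&3\end{smallmatrix},\ \begin{smallmatrix}4&1\\3&2\end{smallmatrix}$ (the *1-converters*); $C_1,\dots,C_6=\begin{smallmatrix}1&3\\4&2\end{smallmatrix},\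 \begin{smallmatrix}1&4\\3&2\end{smallmatrix},\ \begin{smallmatrix}1&4\\2&3\end{smallmatrix},\ \begin{smallmatrix}2&4\\3&1\end{smallmatrix},\ \begin{smallmatrix}2&3\\4&1\end{smallmatrix},\ \begin{smallmatrix}3&2\\4&1\end{smallmatrix}$; $D_1,\dots,D_6=\begin{smallmatrix}1&2\\4&3\end{smallmatrix},\ \begin{smallmatrix}1&2\\3&4\end{smallmatrix},\ \begin{smallmatrix}1&3\\2&4\end{smallmatrix},\ \begin{smallmatrix}2&1\\3&4\end{smallmatrix},\ \begin{smallmatrix}2&1\\4&3\end{smallmatrix},\ \begin{smallmatrix}3&1\\4&2\end{smallmatrix}$. For a set $\mathcal P$ of standard pieces, $s_n(\mathcal P)$ is the number of standard $n$-puzzles all of whose pieces have reduction in $\mathcal P$. With indices read modulo $6$, let $F_1$ send $A_i,B_i,C_i,D_i$ to $A_{i+3},C_{i+3},B_{i+3},D_{i+3}$, and let $F_2$ send them to $D_i,C_i,B_i,A_i$. The twenty *simple pieces* $\mathcal P_1,\dots,\mathcal P_{20}$ are the sets $\{A_i : i\in I\}$ for $I$, in this order, equal to $123456$; $3$; $6$;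 $123$; $456$; $234$; $156$; $12345$; $12456$; $1245$; $12$; $45$; $15$; $24$; $4$; $1$; $23$; $56$; $2$; $5$ (each written as the list of its elements). For positive integers $i,j,m$ let $P_x(i,j,m)$ be the number of standard $(m-1)$-puzzles (those with $m$ columns) all of whose pieces have reduction in $\mathcal P_x$ and whose rightmost column has bottom entry $i$ and top entry $i+j$. Put $$Q_1(i,j,k,l,m,p)=\sum_{\substack{0\le a\le k-1\\0\le b\le j-1}}\binom{i+a-1}{a}\binom{b+k+l-a-1}{b}\binom{2m-i-b+2p-k-l}{2p-k-l},$$ $$Q_2(i,j,k,l,m,p)=\sum_{\substack{0\le a\le k-1\\0\le b\le j-1\\0\le c\le l-1}}\binom{i+a-1}{a}\binom{b+k-a-1}{b}\binom{c+j-b-1}{c}\binom{2m+2p-k-c-i-j}{2m-i-j},$$ $$Q_3(i,j,k,l,m,p)=\sum_{a=0}^{k-1}\binom{i+j+a-1}{a}\binom{2m+2p-i-j-a}{2p-a},$$ and, for $y\in\{1,2,3\}$, $T_y(i,j,k,l,m,p)=Q_y(i,j,k,l,m,p)$ and $T_{y+3}(i,j,k,l,m,p)=Q_y(k,l,i,j,p,m)$.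 **Theorem.** Let $n\ge1$, $x,z\in\{1,\dots,20\}$, $y\in\{1,\dots,6\}$, $\mathcal P=\mathcal P_x$, $\mathcal Q=\mathcal P_z$, $\mathcal T=\{B_y\}$ and $\overline{\mathcal Q}=F_1\circ F_2(\mathcal Q)$. Then $$s_n(\mathcal P\cup\mathcal T\cup\overline{\mathcal Q})=\sum_{\substack{i+j\le 2m\\ k+l\le 2p\\ m+p=n+1}}P_x(i,j,m)\,T_y(i,j,k,l,m,p)\,P_z(k,l,p)+s_n(\mathcal P)+s_n(\mathcal Q),$$ where $i,j,k,l,m,p$ range over the positive integers. Moreover, for all positive integers $i,j,k,l,m,p$ with $i+j\le 2m$, $k+l\le 2p$, $m+p=n+1$, the numbers $Q_1,Q_2,Q_3$ at $(i,j,k,l,m,p)$ are the numbers of ordered partitions of $\{1,\dots,2n+2\}$ into $A=\{a_1<\dots<a_{2m}\}$ and $B=\{b_1<\dots<b_{2p}\}$ with, respectively, $a_i<b_k<b_{k+l}<a_{i+j}$; $a_i<b_k<a_{i+j}<b_{k+l}$; $a_i<a_{i+j}<b_k<b_{k+l}$. -/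

import Mathlib

namespace StandardPuzzle

/-- The twenty-four standard pieces, by their codes `A_i, B_i, C_i, D_i`; the indices
`1, …, 6` are read modulo `6`, so that `6` is the class `0`. -/
inductive StdPiece where
  | A (i : ZMod 6)
  | B (i : ZMod 6)
  | C (i : ZMod 6)
  | D (i : ZMod 6)

/-- The labels of a standard piece (row `0` is the top row, row `1` the bottom row).
Each list is ordered by the index classes `0 = 6, 1, 2, 3, 4, 5`. -/
def StdPiece.matrix : StdPiece → Matrix (Fin 2) (Fin 2) ℕ
  | .A i => (![!![4, 2; 3, 1], !![4, 3; 1, 2], !![3, 4; 1, 2],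
      !![2, 4; 1, 3], !![3, 4; 2, 1], !![4, 3; 2, 1]] :
        Fin 6 → Matrix (Fin 2) (Fin 2) ℕ) i
  | .B i => (![!![4, 1; 3, 2], !![4, 2; 1, 3], !![3, 2; 1, 4],
      !![2, 3; 1, 4], !![3, 1; 2, 4], !![4, 1; 2, 3]] :
        Fin 6 → Matrix (Fin 2) (Fin 2) ℕ) i
  | .C i => (![!![3, 2; 4, 1], !![1, 3; 4, 2], !![1, 4; 3, 2],
      !![1, 4; 2, 3], !![2, 4; 3, 1], !![2, 3; 4, 1]] :
        Fin 6 → Matrix (Fin 2) (Fin 2) ℕ) i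
  | .D i => (![!![3, 1; 4, 2], !![1, 2; 4, 3], !![1, 2; 3, 4],
      !![1, 3; 2, 4], !![2, 1; 3, 4], !![2, 1; 4, 3]] :
        Fin 6 → Matrix (Fin 2) (Fin 2) ℕ) i

/-- `A_i, B_i, C_i, D_i ↦ A_{i+3}, C_{i+3}, B_{i+3}, D_{i+3}` (exchange of the columns). -/
def F₁ : StdPiece → StdPiece
  | .A i => .A (i + 3)
  | .B i => .C (i + 3)
  | .C i => .B (i + 3)
  | .D i => .D (i + 3)

/-- `A_i, B_i, C_i, D_i ↦ D_i, C_i, B_i, A_i` (exchange of the rows). -/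
def F₂ : StdPiece → StdPiece
  | .A i => .D i
  | .B i => .C i
  | .C i => .B i
  | .D i => .A i

/-- The reduction of a piece: each label is replaced by its rank among the four labels. -/
def reduction (M : Matrix (Fin 2) (Fin 2) ℕ) : Matrix (Fin 2) (Fin 2) ℕ :=
  fun r c => (Finset.univ.filter fun q : Fin 2 × Fin 2 => M q.1 q.2 ≤ M r c).card

/-- The `t`-th piece of a row of `n` pieces, which has `n + 1` columns of labels. -/
def pieceAt {n : ℕ} (α : Matrix (Fin 2) (Fin (n + 1)) ℕ) (t : Fin n) :
    Matrix (Fin 2) (Fin 2) ℕ :=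
  !![α 0 t.castSucc, α 0 t.succ; α 1 t.castSucc, α 1 t.succ]

/-- A standard `n`-puzzle: the labels are exactly `1, …, 2n + 2`, each occurring once. -/
def IsStandard {n : ℕ} (α : Matrix (Fin 2) (Fin (n + 1)) ℕ) : Prop :=
  Set.BijOn (fun q : Fin 2 × Fin (n + 1) => α q.1 q.2) Set.univ (Set.Icc 1 (2 * n + 2))

/-- `S_n(P)`: the standard `n`-puzzles that have `P` as a support. -/
def puzzles (n : ℕ) (P : Set StdPiece) : Set (Matrix (Fin 2) (Fin (n + 1)) ℕ) :=
  {α | IsStandard α ∧ ∀ t : Fin n, ∃ c ∈ P, reduction (pieceAt α t) = c.matrix}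

/-- `s_n(P)`. -/
noncomputable def numPuzzles (n : ℕ) (P : Set StdPiece) : ℕ := (puzzles n P).ncard

/-- The twenty simple pieces, in the order of the table. -/
def simplePiece : ℕ → Set StdPiece
  | 1 => {.A 1, .A 2, .A 3, .A 4, .A 5, .A 6}
  | 2 => {.A 3}
  | 3 => {.A 6}
  | 4 => {.A 1, .A 2, .A 3}
  | 5 => {.A 4, .A 5, .A 6}
  | 6 => {.A 2, .A 3, .A 4}
  | 7 => {.A 1, .A 5, .A 6}
  | 8 => {.A 1, .A 2, .A 3, .A 4, .A 5}
  | 9 => {.A 1, .A 2, .A 4, .A 5, .A 6}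
  | 10 => {.A 1, .A 2, .A 4, .A 5}
  | 11 => {.A 1, .A 2}
  | 12 => {.A 4, .A 5}
  | 13 => {.A 1, .A 5}
  | 14 => {.A 2, .A 4}
  | 15 => {.A 4}
  | 16 => {.A 1}
  | 17 => {.A 2, .A 3}
  | 18 => {.A 5, .A 6}
  | 19 => {.A 2}
  | 20 => {.A 5}
  | _ => ∅

/-- `P_x(i, j, m)`: the number of standard puzzles with `m ≥ 1` columns (that is, with `m - 1`
pieces) that have the `x`-th simple piece as a support, and whose rightmost column has `i`
at the bottom and `i + j` at the top. -/
noncomputable def endCount (x i j m : ℕ) : ℕ :=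
  {α ∈ puzzles (m - 1) (simplePiece x) |
    α 1 (Fin.last (m - 1)) = i ∧ α 0 (Fin.last (m - 1)) = i + j}.ncard

def Q₁ (i j k l m p : ℕ) : ℕ :=
  ∑ a ∈ Finset.Icc 0 (k - 1), ∑ b ∈ Finset.Icc 0 (j - 1),
    (i + a - 1).choose a * (b + k + l - a - 1).choose b *
      (2 * m - i - b + 2 * p - k - l).choose (2 * p - k - l)

def Q₂ (i j k l m p : ℕ) : ℕ :=
  ∑ a ∈ Finset.Icc 0 (k - 1), ∑ b ∈ Finset.Icc 0 (j - 1), ∑ c ∈ Finset.Icc 0 (l - 1),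
    (i + a - 1).choose a * (b + k - a - 1).choose b * (c + j - b - 1).choose c *
      (2 * m + 2 * p - k - c - i - j).choose (2 * m - i - j)

def Q₃ (i j k _l m p : ℕ) : ℕ :=
  ∑ a ∈ Finset.Icc 0 (k - 1),
    (i + j + a - 1).choose a * (2 * m + 2 * p - i - j - a).choose (2 * p - a)

/-- The kernel `T_y(i, j, k, l, m, p)`, for `y = 1, …, 6`. -/
def T : ℕ → ℕ → ℕ → ℕ → ℕ → ℕ → ℕ → ℕ
  | 1, i, j, k, l, m, p => Q₁ i j k l m p
  | 2, i, j, k, l, m, p => Q₂ i j k l m p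
  | 3, i, j, k, l, m, p => Q₃ i j k l m p
  | 4, i, j, k, l, m, p => Q₁ k l i j p m
  | 5, i, j, k, l, m, p => Q₂ k l i j p m
  | 6, i, j, k, l, m, p => Q₃ k l i j p m
  | _, _, _, _, _, _, _ => 0

/-- The pairs `(m, p)` of positive integers with `m + p = N`. -/
def splittings (N : ℕ) : Finset (ℕ × ℕ) :=
  (Finset.HasAntidiagonal.antidiagonal N).filter fun u => 1 ≤ u.1 ∧ 1 ≤ u.2

/-- The pairs `(i, j)` of positive integers with `i + j ≤ N`. -/
def posPairs (N : ℕ) : Finset (ℕ × ℕ) :=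
  (Finset.Icc 1 N ×ˢ Finset.Icc 1 N).filter fun u => u.1 + u.2 ≤ N

/-- The `r`-th smallest element of `A`, for `1 ≤ r ≤ A.card`. -/
noncomputable def element (A : Finset ℕ) (r : ℕ) : ℕ := Nat.nth (fun x => x ∈ A) (r - 1)

/-- The partitions `(A, B)` of `{1, …, N}` into a part `A` with `M` elements `a_1 < a_2 < ⋯`
and its complement `B` with elements `b_1 < b_2 < ⋯`, for which `R a b` holds. -/
def partitions (N M : ℕ) (R : (ℕ → ℕ) → (ℕ → ℕ) → Prop) : Set (Finset ℕ × Finset ℕ) :=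
  {u | Disjoint u.1 u.2 ∧ u.1 ∪ u.2 = Finset.Icc 1 N ∧ u.1.card = M ∧
    R (element u.1) (element u.2)}

end StandardPuzzle

open StandardPuzzle

/-!
Call a column decreasing if its top label exceeds its bottom label. In a piece of type `A` both
columns decrease, in a piece of type `D` both increase, and in a 1-converter `B` the left column
decreases and the right one increases. So in a puzzle with support `P ∪ {B_y} ∪ F₁F₂(Q)`, with `P`
and `Q` of type `A`, the decreasing columns form an initial segment (`lt_iff_lt_descents`). If all
columns decrease, the support is `P`; if none does, it is `F₁F₂(Q)`, and a half-turn gives a puzzle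
with support `Q` (`numPuzzles_image`). Otherwise there is exactly one 1-converter, at the right end
of the initial segment of, say, `m` decreasing columns.

Such a mixed puzzle amounts to three pieces of data (`ncard_mixedPuzzles`): the partition of the
labels into the set `A` of those in the first `m` columns and the set `B` of the others, the
standardization of the first `m` columns, and the standardization of the half-turn of the others.
Reductions depend only on the relative order of the labels, so the two standardizations have supports
`P` and `Q`. If their last columns carry the labels `i, i + j` and `k, k + l`, the piece across the
cut has the labels `a_i, a_{i+j}` on the left and `b_k, b_{k+l}` on the right, and it reduces to
`B_y` exactly when these four are in a prescribed order (`reduction_eq_B_iff`). The number of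
partitions with this order is `T_y`.

To count the partitions, classify them by the positions of the labels that occur in the condition.
If `a` elements of `B` lie below `a_i`, then `a_i = i + a`; the positions cut `{1, …, N}` into blocks
in each of which the number of elements of `A` is known, and the choices in different blocks are
independent (`card_filter_powerset_cut`). This gives the sums of products of binomial coefficients.
-/

namespace StandardPuzzle

open Finset

/-! ### Ranks and elements of a finite set of labels -/

/-- The number of elements of `A` that are at most `t`. -/
def rankIn (A : Finset ℕ) (t : ℕ) : ℕ := (A.filter (· ≤ t)).card

lemma rankIn_eq_count (A : Finset ℕ) (t : ℕ) : rankIn A t = Nat.count (· ∈ A) (t + 1) := by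
  rw [Nat.count_eq_card_filter_range, rankIn]
  congr 1
  ext u
  simp only [mem_filter, mem_range, Nat.lt_succ_iff, and_comm]

lemma rankIn_mono (A : Finset ℕ) : Monotone (rankIn A) := fun s t h =>
  card_le_card fun u hu => by
    simp only [mem_filter] at hu ⊢
    exact ⟨hu.1, hu.2.trans h⟩

lemma rankIn_le_card (A : Finset ℕ) (t : ℕ) : rankIn A t ≤ A.card := card_filter_le _ _

lemma lt_card_toFinset_of_le_card {A : Finset ℕ} {r : ℕ} (h1 : 1 ≤ r) (hr : r ≤ A.card)
    (hf : (Set.ofPred fun x => x ∈ A).Finite) : r - 1 < hf.toFinset.card := by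
  have : hf.toFinset = A := by ext; simp
  rw [this]
  omega

lemma element_mem {A : Finset ℕ} {r : ℕ} (h1 : 1 ≤ r) (hr : r ≤ A.card) : element A r ∈ A :=
  Nat.nth_mem (p := fun x => x ∈ A) (r - 1) (lt_card_toFinset_of_le_card h1 hr)

lemma rankIn_element {A : Finset ℕ} {r : ℕ} (h1 : 1 ≤ r) (hr : r ≤ A.card) :
    rankIn A (element A r) = r := by
  rw [rankIn_eq_count, element, Nat.count_nth_succ (lt_card_toFinset_of_le_card h1 hr)]
  omega

lemma element_rankIn {A : Finset ℕ} {t : ℕ} (ht : t ∈ A) : element A (rankIn A t) = t := by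
  rw [rankIn_eq_count, Nat.count_succ, if_pos ht, element, Nat.add_sub_cancel]
  exact Nat.nth_count (p := fun x => x ∈ A) ht

lemma one_le_rankIn {A : Finset ℕ} {t : ℕ} (ht : t ∈ A) : 1 ≤ rankIn A t :=
  card_pos.2 ⟨t, by simp [ht]⟩

/-- `element A` is the lower adjoint of `rankIn A`. -/
lemma element_le_iff {A : Finset ℕ} {r t : ℕ} (h1 : 1 ≤ r) (hr : r ≤ A.card) :
    element A r ≤ t ↔ r ≤ rankIn A t := by
  constructor
  · intro h
    have := rankIn_mono A h
    rwa [rankIn_element h1 hr] at this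
  · intro h
    by_contra hlt
    have := Nat.le_nth_of_count_le (p := fun x => x ∈ A) (n := t + 1) (k := r - 1)
      (not_le.1 hlt)
    rw [← rankIn_eq_count] at this
    omega

lemma element_eq_iff {A : Finset ℕ} {r t : ℕ} (h1 : 1 ≤ r) (hr : r ≤ A.card) :
    element A r = t ↔ t ∈ A ∧ rankIn A t = r := by
  constructor
  · rintro rfl
    exact ⟨element_mem h1 hr, rankIn_element h1 hr⟩
  · rintro ⟨h, rfl⟩
    exact element_rankIn h

lemma element_lt_element_iff {A : Finset ℕ} {r s : ℕ} (h1 : 1 ≤ r) (hr : r ≤ A.card)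
    (hs1 : 1 ≤ s) (hs : s ≤ A.card) : element A r < element A s ↔ r < s := by
  rw [← not_le, ← not_le, element_le_iff hs1 hs, rankIn_element h1 hr]

lemma rankIn_le_rankIn_iff {A : Finset ℕ} {s t : ℕ} (hs : s ∈ A) :
    rankIn A s ≤ rankIn A t ↔ s ≤ t := by
  rw [← element_le_iff (one_le_rankIn hs) (rankIn_le_card A s), element_rankIn hs]

lemma rankIn_eq_add {A : Finset ℕ} {s t : ℕ} (h : s ≤ t) :
    rankIn A t = rankIn A s + (A ∩ Ioc s t).card := by
  rw [rankIn, rankIn, ← card_union_of_disjoint]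
  · congr 1
    ext u
    simp only [mem_filter, mem_union, mem_inter, mem_Ioc]
    by_cases hu : u ∈ A <;> simp [hu]
    omega
  · rw [disjoint_left]
    intro u
    simp only [mem_filter, mem_inter, mem_Ioc]
    omega

lemma rankIn_zero {A : Finset ℕ} {N : ℕ} (h : A ⊆ Ioc 0 N) : rankIn A 0 = 0 := by
  rw [rankIn, card_eq_zero, filter_eq_empty_iff]
  intro u hu
  have := h hu
  simp only [mem_Ioc] at this
  omega

lemma rankIn_of_subset {A : Finset ℕ} {N : ℕ} (h : A ⊆ Ioc 0 N) : rankIn A N = A.card := by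
  rw [rankIn, filter_true_of_mem]
  intro u hu
  exact (mem_Ioc.1 (h hu)).2

lemma rankIn_add_rankIn_compl {A : Finset ℕ} {N t : ℕ} (h : A ⊆ Ioc 0 N) (ht : t ≤ N) :
    rankIn A t + rankIn (Ioc 0 N \ A) t = t := by
  rw [rankIn, rankIn, ← card_union_of_disjoint]
  · have : A.filter (· ≤ t) ∪ (Ioc 0 N \ A).filter (· ≤ t) = Ioc 0 t := by
      ext u
      have := @h u
      simp only [mem_filter, mem_union, mem_sdiff, mem_Ioc] at this ⊢
      by_cases hu : u ∈ A
      · have := this hu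
        simp only [hu]
        simp
        omega
      · simp only [hu]
        simp
        omega
    rw [this, Nat.card_Ioc]
    omega
  · rw [disjoint_left]
    intro u
    simp only [mem_filter, mem_sdiff]
    tauto

/-! ### Counting subsets of an interval block by block -/

/-- Conditions on the traces of a set on two disjoint sets are independent. -/
lemma card_filter_powerset_split {α : Type*} [DecidableEq α] {X Y : Finset α}
    (hXY : Disjoint X Y) (p q : Finset α → Prop) [DecidablePred p] [DecidablePred q] :
    ((X ∪ Y).powerset.filter fun A => p (A ∩ X) ∧ q (A ∩ Y)).card =
      (X.powerset.filter p).card * (Y.powerset.filter q).card := by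
  rw [← card_product]
  refine card_nbij' (fun A => (A ∩ X, A ∩ Y)) (fun u => u.1 ∪ u.2) ?_ ?_ ?_ ?_
  · intro A hA
    simp only [coe_filter, mem_powerset, Set.mem_ofPred_eq, mem_coe, mem_product, mem_filter] at *
    exact ⟨⟨inter_subset_right, hA.2.1⟩, ⟨inter_subset_right, hA.2.2⟩⟩
  · rintro ⟨U, V⟩ hU
    simp only [coe_filter, mem_powerset, Set.mem_ofPred_eq, mem_coe, mem_product, mem_filter] at *
    obtain ⟨⟨h1, h2⟩, h3, h4⟩ := hU
    have e1 : (U ∪ V) ∩ X = U := by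
      rw [union_inter_distrib_right, inter_eq_left.2 h1,
        disjoint_iff_inter_eq_empty.1 (hXY.symm.mono_left h3), union_empty]
    have e2 : (U ∪ V) ∩ Y = V := by
      rw [union_inter_distrib_right, inter_eq_left.2 h3,
        disjoint_iff_inter_eq_empty.1 (hXY.mono_left h1), empty_union]
    rw [e1, e2]
    exact ⟨union_subset_union h1 h3, h2, h4⟩
  · intro A hA
    simp only [coe_filter, mem_powerset, Set.mem_ofPred_eq] at hA
    simp only
    rw [← inter_union_distrib_left, inter_eq_left.2 hA.1]
  · rintro ⟨U, V⟩ hU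
    simp only [mem_coe, mem_product, mem_filter, mem_powerset] at hU
    obtain ⟨⟨h1, h2⟩, h3, h4⟩ := hU
    simp only [Prod.mk.injEq]
    constructor
    · rw [union_inter_distrib_right, inter_eq_left.2 h1,
        disjoint_iff_inter_eq_empty.1 (hXY.symm.mono_left h3), union_empty]
    · rw [union_inter_distrib_right, inter_eq_left.2 h3,
        disjoint_iff_inter_eq_empty.1 (hXY.mono_left h1), empty_union]

lemma card_filter_powerset_Ioc (s x u : ℕ) :
    ((Ioc s x).powerset.filter fun A => A.card = u).card = (x - s).choose u := by
  rw [← powersetCard_eq_filter, card_powersetCard, Nat.card_Ioc]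

lemma Ioc_eq_union_singleton {s x : ℕ} (h : s < x) : Ioc s x = Ioc s (x - 1) ∪ {x} := by
  ext u
  simp only [mem_Ioc, mem_union, mem_singleton]
  omega

lemma disjoint_Ioc_singleton (s x : ℕ) : Disjoint (Ioc s (x - 1)) {x} := by
  rw [disjoint_singleton_right, mem_Ioc]
  omega

lemma card_inter_Ioc {A : Finset ℕ} {s x : ℕ} (h : s < x) :
    (A ∩ Ioc s x).card = (A ∩ Ioc s (x - 1)).card + (A ∩ {x}).card := by
  rw [Ioc_eq_union_singleton h, inter_union_distrib_left, card_union_of_disjoint]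
  exact (disjoint_Ioc_singleton s x).mono inter_subset_right inter_subset_right

lemma inter_singleton_card (A : Finset ℕ) (x : ℕ) :
    (A ∩ {x}).card = if x ∈ A then 1 else 0 := by
  split_ifs with h <;> simp [h]

/-- Cutting the block `(s, x]` off the front of the interval `(s, N]`; `ε` says whether the last
point `x` of the block is chosen. -/
lemma card_filter_powerset_cut {s x N u ε : ℕ} (hs : s < x) (hx : x ≤ N) (hε : ε ≤ 1)
    (q : Finset ℕ → Prop) [DecidablePred q] (hq : ∀ A, q (A ∩ Ioc x N) ↔ q A) :
    ((Ioc s N).powerset.filter fun A =>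
      (A ∩ Ioc s (x - 1)).card = u ∧ (A ∩ {x}).card = ε ∧ q A).card =
      (x - s - 1).choose u * ((Ioc x N).powerset.filter q).card := by
  have hU : Ioc s N = Ioc s (x - 1) ∪ ({x} ∪ Ioc x N) := by
    ext t
    simp only [mem_Ioc, mem_union, mem_singleton]
    omega
  have hd1 : Disjoint (Ioc s (x - 1)) ({x} ∪ Ioc x N) := by
    rw [disjoint_left]
    intro t
    simp only [mem_Ioc, mem_union, mem_singleton]
    omega
  have hd2 : Disjoint {x} (Ioc x N) := by simp
  have h2 := card_filter_powerset_split hd2 (fun A => A.card = ε) q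
  have h1 := card_filter_powerset_split hd1 (fun A => A.card = u)
    (fun A => (A ∩ {x}).card = ε ∧ q (A ∩ Ioc x N))
  have h3 : (({x} : Finset ℕ).powerset.filter fun A => A.card = ε).card = 1 := by
    rw [← powersetCard_eq_filter, card_powersetCard, card_singleton]
    interval_cases ε <;> rfl
  rw [h2, h3, card_filter_powerset_Ioc, one_mul] at h1
  rw [hU, show x - s - 1 = x - 1 - s by omega, ← h1]
  congr 1
  refine filter_congr fun A _ => ?_
  have e1 : A ∩ ({x} ∪ Ioc x N) ∩ {x} = A ∩ {x} := by
    rw [inter_assoc, inter_eq_right.2 subset_union_left]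
  have e2 : A ∩ ({x} ∪ Ioc x N) ∩ Ioc x N = A ∩ Ioc x N := by
    rw [inter_assoc, inter_eq_right.2 subset_union_right]
  rw [e1, e2, hq]

/-- Splitting a block that ends at a chosen element `x` off the front of an interval. -/
lemma card_filter_powerset_cut_mem {s x N u : ℕ} (hs : s < x) (hx : x ≤ N)
    (q : Finset ℕ → Prop) [DecidablePred q] (hq : ∀ A, q (A ∩ Ioc x N) ↔ q A) :
    ((Ioc s N).powerset.filter fun A => x ∈ A ∧ (A ∩ Ioc s x).card = u + 1 ∧ q A).card =
      (x - s - 1).choose u * ((Ioc x N).powerset.filter q).card := by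
  rw [← card_filter_powerset_cut hs hx le_rfl q hq]
  congr 1
  refine filter_congr fun A _ => ?_
  rw [card_inter_Ioc hs, inter_singleton_card]
  by_cases hxA : x ∈ A <;> simp [hxA]

/-- Splitting a block that ends at an omitted point `x` off the front of an interval. -/
lemma card_filter_powerset_cut_notMem {s x N u : ℕ} (hs : s < x) (hx : x ≤ N)
    (q : Finset ℕ → Prop) [DecidablePred q] (hq : ∀ A, q (A ∩ Ioc x N) ↔ q A) :
    ((Ioc s N).powerset.filter fun A => x ∉ A ∧ (A ∩ Ioc s x).card = u ∧ q A).card =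
      (x - s - 1).choose u * ((Ioc x N).powerset.filter q).card := by
  rw [← card_filter_powerset_cut hs hx zero_le_one q hq]
  congr 1
  refine filter_congr fun A _ => ?_
  rw [card_inter_Ioc hs, inter_singleton_card]
  by_cases hxA : x ∈ A <;> simp [hxA]

/-! ### The kernels as numbers of ordered partitions -/

open Classical in
/-- A partition is determined by its first part. -/
lemma ncard_partitions (N M : ℕ) (R : (ℕ → ℕ) → (ℕ → ℕ) → Prop) :
    (partitions N M R).ncard = ((Ioc 0 N).powerset.filter fun A =>
      A.card = M ∧ R (element A) (element (Ioc 0 N \ A))).card := by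
  rw [← Set.ncard_coe_finset]
  have hI : Icc 1 N = Ioc 0 N := by
    ext u
    simp only [mem_Icc, mem_Ioc]
    omega
  refine Set.ncard_congr (fun u _ => u.1) ?_ ?_ ?_
  · rintro ⟨A, B⟩ ⟨hd, hu, hM, hR⟩
    simp only at hd hu hM hR
    rw [hI] at hu
    have hB : Ioc 0 N \ A = B := by
      rw [← hu, union_sdiff_left, sdiff_eq_self_of_disjoint hd.symm]
    simp only [coe_filter, mem_powerset, Set.mem_ofPred_eq, hB]
    exact ⟨hu ▸ subset_union_left, hM, hR⟩
  · rintro ⟨A, B⟩ ⟨A', B'⟩ ⟨hd, hu, -, -⟩ ⟨hd', hu', -, -⟩ h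
    simp only at hd hu hd' hu' h
    subst h
    rw [Prod.mk.injEq]
    refine ⟨rfl, ?_⟩
    rw [← sdiff_eq_self_of_disjoint hd.symm, ← sdiff_eq_self_of_disjoint hd'.symm,
      ← union_sdiff_left, hu, ← hu', union_sdiff_left]
  · intro A hA
    simp only [coe_filter, mem_powerset, Set.mem_ofPred_eq] at hA
    refine ⟨(A, Ioc 0 N \ A), ⟨disjoint_sdiff, ?_, hA.2.1, hA.2.2⟩, rfl⟩
    rw [hI]
    exact union_sdiff_of_subset hA.1

/-- A label of a part of `{1, …, N}`, its rank there, and the number of labels of the other part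
below it. -/
lemma element_spec {A B : Finset ℕ} {N r : ℕ} (hA : A ⊆ Ioc 0 N)
    (hB : ∀ t ≤ N, rankIn A t + rankIn B t = t) (h1 : 1 ≤ r) (hr : r ≤ A.card) :
    element A r ∈ A ∧ element A r ≤ N ∧ rankIn A (element A r) = r ∧
      r + rankIn B (element A r) = element A r := by
  have h := element_mem h1 hr
  have hN := (mem_Ioc.1 (hA h)).2
  have := hB _ hN
  rw [rankIn_element h1 hr] at this
  exact ⟨h, hN, rankIn_element h1 hr, this⟩

lemma inter_Ioc_inter_Ioc {s s' t t' : ℕ} (A : Finset ℕ) (hs : s ≤ s') (ht : t' ≤ t) :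
    A ∩ Ioc s t ∩ Ioc s' t' = A ∩ Ioc s' t' := by
  rw [inter_assoc, inter_eq_right.2 (Ioc_subset_Ioc hs ht)]

lemma mem_inter_Ioc_iff {s t x : ℕ} (A : Finset ℕ) (hs : s < x) (ht : x ≤ t) :
    x ∈ A ∩ Ioc s t ↔ x ∈ A := by
  simp [hs, ht]

/-- The fibre of the third kernel: the position of `a_r` determines two blocks. -/
lemma card_fibre_one {N M r a : ℕ} (hr : 1 ≤ r) (hM : r ≤ M) (hN : r + a ≤ N) :
    ((Ioc 0 N).powerset.filter fun A =>
      r + a ∈ A ∧ rankIn A (r + a) = r ∧ A.card = M).card =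
      (r + a - 1).choose a * (N - (r + a)).choose (M - r) := by
  obtain ⟨r, rfl⟩ : ∃ r', r = r' + 1 := ⟨r - 1, by omega⟩
  have h := card_filter_powerset_cut_mem (s := 0) (x := r + 1 + a) (N := N) (u := r) (by omega) hN
    (fun A => (A ∩ Ioc (r + 1 + a) N).card = M - (r + 1))
    (fun A => by simp only [inter_Ioc_inter_Ioc A le_rfl le_rfl])
  have h' : ((Ioc (r + 1 + a) N).powerset.filter fun A =>
      (A ∩ Ioc (r + 1 + a) N).card = M - (r + 1)).card = (N - (r + 1 + a)).choose (M - (r + 1)) := by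
    rw [← card_filter_powerset_Ioc]
    congr 1
    refine filter_congr fun A hA => ?_
    rw [inter_eq_left.2 (mem_powerset.1 hA)]
  rw [h'] at h
  rw [show r + 1 + a - 0 - 1 = r + a by omega] at h
  rw [show r + 1 + a - 1 = r + a by omega, ← Nat.choose_symm_add, ← h]
  congr 1
  refine filter_congr fun A hA => and_congr_right fun _ => ?_
  have hA := mem_powerset.1 hA
  have e0 := rankIn_zero hA
  have eN := rankIn_of_subset hA
  have e1 := rankIn_eq_add (A := A) (Nat.zero_le (r + 1 + a))
  have e2 := rankIn_eq_add (A := A) hN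
  omega

/-- The fibre of the first kernel: the positions of `a_r` and of a label of `B` determine three
blocks. -/
lemma card_fibre_two {N M r x y u : ℕ} (hr : 1 ≤ r) (hx : r ≤ x) (hxy : x < y) (hy : y ≤ N)
    (hu : r + u ≤ M) :
    ((Ioc 0 N).powerset.filter fun A => x ∈ A ∧ rankIn A x = r ∧
      y ∉ A ∧ rankIn A y = r + u ∧ A.card = M).card =
      (x - 1).choose (r - 1) * ((y - x - 1).choose u * (N - y).choose (M - (r + u))) := by
  obtain ⟨r, rfl⟩ : ∃ r', r = r' + 1 := ⟨r - 1, by omega⟩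
  have h' : ((Ioc y N).powerset.filter fun A =>
      (A ∩ Ioc y N).card = M - (r + 1 + u)).card = (N - y).choose (M - (r + 1 + u)) := by
    rw [← card_filter_powerset_Ioc]
    congr 1
    refine filter_congr fun A hA => ?_
    rw [inter_eq_left.2 (mem_powerset.1 hA)]
  have h2 := card_filter_powerset_cut_notMem (s := x) (x := y) (N := N) (u := u) hxy hy
    (fun A => (A ∩ Ioc y N).card = M - (r + 1 + u))
    (fun A => by simp only [inter_Ioc_inter_Ioc A le_rfl le_rfl])
  have h := card_filter_powerset_cut_mem (s := 0) (x := x) (N := N) (u := r) (by omega) (by omega)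
    (fun A => y ∉ A ∧ (A ∩ Ioc x y).card = u ∧ (A ∩ Ioc y N).card = M - (r + 1 + u))
    (fun A => by
      simp only [inter_Ioc_inter_Ioc A le_rfl hy, inter_Ioc_inter_Ioc A hxy.le le_rfl,
        mem_inter_Ioc_iff A hxy hy])
  rw [h2, h', Nat.sub_zero] at h
  rw [Nat.add_sub_cancel, ← h]
  congr 1
  refine filter_congr fun A hA => and_congr_right fun _ => ?_
  have hA := mem_powerset.1 hA
  have e0 := rankIn_zero hA
  have eN := rankIn_of_subset hA
  have e1 := rankIn_eq_add (A := A) (Nat.zero_le x)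
  have e2 := rankIn_eq_add (A := A) hxy.le
  have e3 := rankIn_eq_add (A := A) hy
  constructor
  · rintro ⟨h1, h2, h3, h4⟩
    exact ⟨by omega, h2, by omega, by omega⟩
  · rintro ⟨h1, h2, h3, h4⟩
    exact ⟨by omega, h2, by omega, by omega⟩

/-- The fibre of the second kernel: the positions of `a_r`, of a label of `B` and of a later label
of `A` determine four blocks. -/
lemma card_fibre_three {N M r x y w u v : ℕ} (hr : 1 ≤ r) (hx : r ≤ x) (hxy : x < y) (hyw : y < w)
    (hw : w ≤ N) (hu : r + u + v + 1 ≤ M) :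
    ((Ioc 0 N).powerset.filter fun A => x ∈ A ∧ rankIn A x = r ∧
      y ∉ A ∧ rankIn A y = r + u ∧ w ∈ A ∧ rankIn A w = r + u + v + 1 ∧ A.card = M).card =
      (x - 1).choose (r - 1) * ((y - x - 1).choose u * ((w - y - 1).choose v *
        (N - w).choose (M - (r + u + v + 1)))) := by
  obtain ⟨r, rfl⟩ : ∃ r', r = r' + 1 := ⟨r - 1, by omega⟩
  set z := M - (r + 1 + u + v + 1) with hz
  have h' : ((Ioc w N).powerset.filter fun A =>
      (A ∩ Ioc w N).card = z).card = (N - w).choose z := by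
    rw [← card_filter_powerset_Ioc]
    congr 1
    refine filter_congr fun A hA => ?_
    rw [inter_eq_left.2 (mem_powerset.1 hA)]
  have h3 := card_filter_powerset_cut_mem (s := y) (x := w) (N := N) (u := v) hyw hw
    (fun A => (A ∩ Ioc w N).card = z)
    (fun A => by simp only [inter_Ioc_inter_Ioc A le_rfl le_rfl])
  have h2 := card_filter_powerset_cut_notMem (s := x) (x := y) (N := N) (u := u) hxy (by omega)
    (fun A => w ∈ A ∧ (A ∩ Ioc y w).card = v + 1 ∧ (A ∩ Ioc w N).card = z)
    (fun A => by
      simp only [inter_Ioc_inter_Ioc A le_rfl hw, inter_Ioc_inter_Ioc A hyw.le le_rfl,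
        mem_inter_Ioc_iff A hyw hw])
  have h := card_filter_powerset_cut_mem (s := 0) (x := x) (N := N) (u := r) (by omega) (by omega)
    (fun A => y ∉ A ∧ (A ∩ Ioc x y).card = u ∧ w ∈ A ∧ (A ∩ Ioc y w).card = v + 1 ∧
      (A ∩ Ioc w N).card = z)
    (fun A => by
      simp only [inter_Ioc_inter_Ioc A le_rfl (hyw.le.trans hw), inter_Ioc_inter_Ioc A hxy.le hw,
        inter_Ioc_inter_Ioc A (hxy.le.trans hyw.le) le_rfl,
        mem_inter_Ioc_iff A hxy (hyw.le.trans hw), mem_inter_Ioc_iff A (hxy.trans hyw) hw])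
  rw [h2, h3, h', Nat.sub_zero] at h
  rw [Nat.add_sub_cancel, ← h]
  congr 1
  refine filter_congr fun A hA => and_congr_right fun _ => ?_
  have hA := mem_powerset.1 hA
  have e0 := rankIn_zero hA
  have eN := rankIn_of_subset hA
  have e1 := rankIn_eq_add (A := A) (Nat.zero_le x)
  have e2 := rankIn_eq_add (A := A) hxy.le
  have e3 := rankIn_eq_add (A := A) hyw.le
  have e4 := rankIn_eq_add (A := A) hw
  constructor
  · rintro ⟨h1, h2, h3, h4, h5, h6⟩
    exact ⟨by omega, h2, by omega, h4, by omega, by omega⟩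
  · rintro ⟨h1, h2, h3, h4, h5, h6⟩
    exact ⟨by omega, h2, by omega, h4, by omega, by omega⟩

/-- The parameters `(i, j, k, l, m, p)` at which the kernels count partitions. -/
structure Admissible (i j k l m p : ℕ) : Prop where
  i_pos : 1 ≤ i
  j_pos : 1 ≤ j
  k_pos : 1 ≤ k
  l_pos : 1 ≤ l
  left : i + j ≤ 2 * m
  right : k + l ≤ 2 * p

lemma card_compl {A : Finset ℕ} {M P : ℕ} (hA : A ⊆ Ioc 0 (M + P)) (hM : A.card = M) :
    (Ioc 0 (M + P) \ A).card = P := by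
  rw [card_sdiff_of_subset hA, Nat.card_Ioc]
  omega

lemma rankIn_compl_add {A : Finset ℕ} {N t : ℕ} (h : A ⊆ Ioc 0 N) (ht : t ≤ N) :
    rankIn (Ioc 0 N \ A) t + rankIn A t = t := by
  rw [add_comm]
  exact rankIn_add_rankIn_compl h ht

/-- The summation index is the number of elements of `B` below `a_{i+j}`. -/
theorem Q₃_eq_ncard {i j k l m p : ℕ} (h : Admissible i j k l m p) :
    Q₃ i j k l m p = (partitions (2 * m + 2 * p) (2 * m) fun a b =>
      a i < a (i + j) ∧ a (i + j) < b k ∧ b k < b (k + l)).ncard := by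
  classical
  obtain ⟨hi, hj, hk, hl, hm, hp⟩ := h
  rw [ncard_partitions, card_eq_sum_card_fiberwise (f := fun A => element A (i + j) - (i + j))
    (t := Icc 0 (k - 1))]
  · rw [Q₃]
    refine sum_congr rfl fun a ha => ?_
    rw [mem_Icc] at ha
    have hc := card_fibre_one (N := 2 * m + 2 * p) (M := 2 * m) (r := i + j) (a := a) (by omega)
      (by omega) (by omega)
    have e : 2 * m + 2 * p - (i + j + a) = (2 * m - (i + j)) + (2 * p - a) := by omega
    -- The kernel counts the elements of `B` in the last block, the fibre those of `A`.
    rw [e, Nat.choose_symm_add, ← e] at hc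
    rw [show 2 * m + 2 * p - i - j - a = 2 * m + 2 * p - (i + j + a) by omega, ← hc]
    symm
    congr 1
    ext A
    simp only [mem_filter, mem_powerset, and_assoc]
    refine and_congr_right fun hA => ?_
    have hAB := fun t ht => rankIn_add_rankIn_compl (t := t) hA ht
    constructor
    · rintro ⟨hM, h1, h2, h3, h4⟩
      have hP := card_compl hA hM
      obtain ⟨w1, w2, w3, w4⟩ := element_spec (r := i + j) hA hAB (by omega) (by omega)
      have hw : element A (i + j) = i + j + a := by omega
      rw [hw] at w1 w3
      exact ⟨w1, w3, hM⟩
    · rintro ⟨w1, w3, hM⟩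
      have hP := card_compl hA hM
      have hw := (element_eq_iff (r := i + j) (by omega) (by omega)).2 ⟨w1, w3⟩
      have c1 := element_le_iff (A := Ioc 0 (2 * m + 2 * p) \ A) (r := k) (t := i + j + a) hk
        (by omega)
      have hx := hAB (i + j + a) (by omega)
      refine ⟨hM, (element_lt_element_iff hi (by omega) (by omega) (by omega)).2 (by omega), ?_,
        (element_lt_element_iff hk (by omega) (by omega) (by omega)).2 (by omega), ?_⟩ <;> omega
  · intro A hA
    simp only [coe_filter, mem_powerset, Set.mem_ofPred_eq] at hA
    obtain ⟨hA, hM, h1, h2, h3⟩ := hA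
    have hAB := fun t ht => rankIn_add_rankIn_compl (t := t) hA ht
    have hP := card_compl hA hM
    obtain ⟨w1, w2, w3, w4⟩ := element_spec (r := i + j) hA hAB (by omega) (by omega)
    have c1 := element_le_iff (A := Ioc 0 (2 * m + 2 * p) \ A) (r := k) (t := element A (i + j)) hk
      (by omega)
    simp only [coe_Icc, Set.mem_Icc]
    omega

/-- The summation indices are the number of elements of `B` below `a_i` and the number of elements
of `A` between `a_i` and `b_{k+l}`. -/
theorem Q₁_eq_ncard {i j k l m p : ℕ} (h : Admissible i j k l m p) :
    Q₁ i j k l m p = (partitions (2 * m + 2 * p) (2 * m) fun a b =>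
      a i < b k ∧ b k < b (k + l) ∧ b (k + l) < a (i + j)).ncard := by
  classical
  obtain ⟨hi, hj, hk, hl, hm, hp⟩ := h
  rw [ncard_partitions, card_eq_sum_card_fiberwise (f := fun A => (element A i - i,
    element (Ioc 0 (2 * m + 2 * p) \ A) (k + l) - (i + k + l)))
    (t := Icc 0 (k - 1) ×ˢ Icc 0 (j - 1))]
  · rw [Q₁, sum_product]
    refine sum_congr rfl fun a ha => sum_congr rfl fun b hb => ?_
    rw [mem_Icc] at ha hb
    have hc := card_fibre_two (N := 2 * m + 2 * p) (M := 2 * m) (r := i) (x := i + a)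
      (y := i + b + k + l) (u := b) hi (by omega) (by omega) (by omega) (by omega)
    have e : 2 * m + 2 * p - (i + b + k + l) = (2 * m - (i + b)) + (2 * p - (k + l)) := by omega
    have e' : i + a - 1 = (i - 1) + a := by omega
    rw [e, Nat.choose_symm_add, ← e, e', Nat.choose_symm_add, ← e', ← mul_assoc] at hc
    rw [show 2 * m - i - b + 2 * p - k - l = 2 * m + 2 * p - (i + b + k + l) by omega,
      show 2 * p - k - l = 2 * p - (k + l) by omega,
      show b + k + l - a - 1 = i + b + k + l - (i + a) - 1 by omega, ← hc]
    symm
    congr 1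
    ext A
    simp only [mem_filter, mem_powerset, and_assoc, Prod.mk.injEq]
    refine and_congr_right fun hA => ?_
    have hAB := fun t ht => rankIn_add_rankIn_compl (t := t) hA ht
    have hBA := fun t ht => rankIn_compl_add (t := t) hA ht
    constructor
    · rintro ⟨hM, h1, h2, h3, h4, h5⟩
      have hP := card_compl hA hM
      obtain ⟨x1, x2, x3, x4⟩ := element_spec (r := i) hA hAB (by omega) (by omega)
      obtain ⟨y1, y2, y3, y4⟩ := element_spec (r := k + l) sdiff_subset hBA (by omega) (by omega)
      have c1 := element_le_iff (A := A) (r := i)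
        (t := element (Ioc 0 (2 * m + 2 * p) \ A) (k + l)) (by omega) (by omega)
      have ex : element A i = i + a := by omega
      have ey : element (Ioc 0 (2 * m + 2 * p) \ A) (k + l) = i + b + k + l := by omega
      rw [ex] at x1 x3
      rw [ey] at y1 y3
      have := hAB (i + b + k + l) (by omega)
      exact ⟨x1, x3, (mem_sdiff.1 y1).2, by omega, hM⟩
    · rintro ⟨x1, x3, y1, y3, hM⟩
      have hP := card_compl hA hM
      have hx := hAB (i + a) (by omega)
      have hy := hAB (i + b + k + l) (by omega)
      have ex := (element_eq_iff (r := i) (by omega) (by omega)).2 ⟨x1, x3⟩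
      have ey := (element_eq_iff (A := Ioc 0 (2 * m + 2 * p) \ A) (r := k + l)
        (t := i + b + k + l) (by omega) (by omega)).2
        ⟨mem_sdiff.2 ⟨mem_Ioc.2 ⟨by omega, by omega⟩, y1⟩, by omega⟩
      have c1 := element_le_iff (A := Ioc 0 (2 * m + 2 * p) \ A) (r := k) (t := i + a) hk
        (by omega)
      have c2 := element_le_iff (A := A) (r := i + j) (t := i + b + k + l) (by omega)
        (by omega)
      refine ⟨hM, by omega,
        (element_lt_element_iff hk (by omega) (by omega) (by omega)).2 (by omega), ?_, ?_, ?_⟩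
      all_goals omega
  · intro A hA
    simp only [coe_filter, mem_powerset, Set.mem_ofPred_eq] at hA
    obtain ⟨hA, hM, h1, h2, h3⟩ := hA
    have hAB := fun t ht => rankIn_add_rankIn_compl (t := t) hA ht
    have hBA := fun t ht => rankIn_compl_add (t := t) hA ht
    have hP := card_compl hA hM
    obtain ⟨x1, x2, x3, x4⟩ := element_spec (r := i) hA hAB (by omega) (by omega)
    obtain ⟨y1, y2, y3, y4⟩ := element_spec (r := k + l) sdiff_subset hBA (by omega) (by omega)
    have c1 := element_le_iff (A := Ioc 0 (2 * m + 2 * p) \ A) (r := k) (t := element A i) hk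
      (by omega)
    have c2 := element_le_iff (A := A) (r := i + j)
      (t := element (Ioc 0 (2 * m + 2 * p) \ A) (k + l)) (by omega) (by omega)
    simp only [coe_product, coe_Icc, Set.mem_prod, Set.mem_Icc]
    omega

/-- The summation indices are the number of elements of `B` below `a_i`, the number of elements of
`A` between `a_i` and `b_k`, and the number of elements of `B` between `b_k` and `a_{i+j}`. -/
theorem Q₂_eq_ncard {i j k l m p : ℕ} (h : Admissible i j k l m p) :
    Q₂ i j k l m p = (partitions (2 * m + 2 * p) (2 * m) fun a b =>
      a i < b k ∧ b k < a (i + j) ∧ a (i + j) < b (k + l)).ncard := by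
  classical
  obtain ⟨hi, hj, hk, hl, hm, hp⟩ := h
  rw [ncard_partitions, card_eq_sum_card_fiberwise (f := fun A => (element A i - i,
    element (Ioc 0 (2 * m + 2 * p) \ A) k - (i + k), element A (i + j) - (i + j + k)))
    (t := Icc 0 (k - 1) ×ˢ Icc 0 (j - 1) ×ˢ Icc 0 (l - 1))]
  · rw [Q₂, sum_product]
    refine sum_congr rfl fun a ha => ?_
    rw [sum_product]
    refine sum_congr rfl fun b hb => sum_congr rfl fun c hc => ?_
    rw [mem_Icc] at ha hb hc
    have hf := card_fibre_three (N := 2 * m + 2 * p) (M := 2 * m) (r := i) (x := i + a)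
      (y := i + b + k) (w := i + j + k + c) (u := b) (v := j - b - 1) hi (by omega) (by omega)
      (by omega) (by omega) (by omega)
    have e : i + b + (j - b - 1) + 1 = i + j := by omega
    have e' : i + a - 1 = (i - 1) + a := by omega
    have e'' : i + j + k + c - (i + b + k) - 1 = (j - b - 1) + c := by omega
    rw [e, e', e'', Nat.choose_symm_add, Nat.choose_symm_add, ← e', ← e'', ← mul_assoc,
      ← mul_assoc] at hf
    rw [show 2 * m + 2 * p - k - c - i - j = 2 * m + 2 * p - (i + j + k + c) by omega,
      show 2 * m - i - j = 2 * m - (i + j) by omega,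
      show b + k - a - 1 = i + b + k - (i + a) - 1 by omega,
      show c + j - b - 1 = i + j + k + c - (i + b + k) - 1 by omega, ← hf]
    symm
    congr 1
    ext A
    simp only [mem_filter, mem_powerset, and_assoc, Prod.mk.injEq]
    refine and_congr_right fun hA => ?_
    have hAB := fun t ht => rankIn_add_rankIn_compl (t := t) hA ht
    have hBA := fun t ht => rankIn_compl_add (t := t) hA ht
    constructor
    · rintro ⟨hM, h1, h2, h3, h4, h5, h6⟩
      have hP := card_compl hA hM
      obtain ⟨x1, x2, x3, x4⟩ := element_spec (r := i) hA hAB (by omega) (by omega)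
      obtain ⟨y1, y2, y3, y4⟩ := element_spec (r := k) sdiff_subset hBA (by omega) (by omega)
      obtain ⟨w1, w2, w3, w4⟩ := element_spec (r := i + j) hA hAB (by omega) (by omega)
      have c1 := element_le_iff (A := A) (r := i)
        (t := element (Ioc 0 (2 * m + 2 * p) \ A) k) (by omega) (by omega)
      have c2 := element_le_iff (A := Ioc 0 (2 * m + 2 * p) \ A) (r := k)
        (t := element A (i + j)) (by omega) (by omega)
      have ex : element A i = i + a := by omega
      have ey : element (Ioc 0 (2 * m + 2 * p) \ A) k = i + b + k := by omega
      have ew : element A (i + j) = i + j + k + c := by omega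
      rw [ex] at x1 x3
      rw [ey] at y1 y3
      rw [ew] at w1 w3
      have := hAB (i + b + k) (by omega)
      exact ⟨x1, x3, (mem_sdiff.1 y1).2, by omega, w1, w3, hM⟩
    · rintro ⟨x1, x3, y1, y3, w1, w3, hM⟩
      have hP := card_compl hA hM
      have hx := hAB (i + a) (by omega)
      have hy := hAB (i + b + k) (by omega)
      have hw := hAB (i + j + k + c) (by omega)
      have ex := (element_eq_iff (r := i) (by omega) (by omega)).2 ⟨x1, x3⟩
      have ew := (element_eq_iff (r := i + j) (by omega) (by omega)).2 ⟨w1, w3⟩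
      have ey := (element_eq_iff (A := Ioc 0 (2 * m + 2 * p) \ A) (r := k)
        (t := i + b + k) (by omega) (by omega)).2
        ⟨mem_sdiff.2 ⟨mem_Ioc.2 ⟨by omega, by omega⟩, y1⟩, by omega⟩
      have c1 := element_le_iff (A := Ioc 0 (2 * m + 2 * p) \ A) (r := k + l)
        (t := i + j + k + c) (by omega) (by omega)
      refine ⟨hM, ?_, ?_, ?_, ?_, ?_, ?_⟩
      all_goals omega
  · intro A hA
    simp only [coe_filter, mem_powerset, Set.mem_ofPred_eq] at hA
    obtain ⟨hA, hM, h1, h2, h3⟩ := hA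
    have hAB := fun t ht => rankIn_add_rankIn_compl (t := t) hA ht
    have hBA := fun t ht => rankIn_compl_add (t := t) hA ht
    have hP := card_compl hA hM
    obtain ⟨x1, x2, x3, x4⟩ := element_spec (r := i) hA hAB (by omega) (by omega)
    obtain ⟨y1, y2, y3, y4⟩ := element_spec (r := k) sdiff_subset hBA (by omega) (by omega)
    obtain ⟨w1, w2, w3, w4⟩ := element_spec (r := i + j) hA hAB (by omega) (by omega)
    have c1 := element_le_iff (A := Ioc 0 (2 * m + 2 * p) \ A) (r := k) (t := element A i) hk
      (by omega)
    have c2 := element_le_iff (A := A) (r := i + j)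
      (t := element (Ioc 0 (2 * m + 2 * p) \ A) k) (by omega) (by omega)
    have c3 := element_le_iff (A := Ioc 0 (2 * m + 2 * p) \ A) (r := k + l)
      (t := element A (i + j)) (by omega) (by omega)
    simp only [coe_product, coe_Icc, Set.mem_prod, Set.mem_Icc]
    omega

/-- Exchanging the two parts. -/
lemma partitions_swap (N M P : ℕ) (hN : N = M + P) (R : (ℕ → ℕ) → (ℕ → ℕ) → Prop) :
    (partitions N P R).ncard = (partitions N M fun a b => R b a).ncard := by
  have hc : ∀ {A B : Finset ℕ} {S T : ℕ}, Disjoint A B → A ∪ B = Icc 1 N → N = S + T →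
      A.card = S → B.card = T := by
    intro A B S T hd hu hN hS
    have := card_union_of_disjoint hd
    rw [hu, Nat.card_Icc] at this
    omega
  refine Set.ncard_congr (fun u _ => u.swap) ?_ ?_ ?_
  · rintro ⟨A, B⟩ ⟨hd, hu, hM, hR⟩
    exact ⟨hd.symm, (union_comm _ _).trans hu, hc hd hu (by omega) hM, hR⟩
  · intro u v _ _ h
    exact Prod.swap_injective h
  · rintro ⟨A, B⟩ ⟨hd, hu, hM, hR⟩
    exact ⟨(B, A), ⟨hd.symm, (union_comm _ _).trans hu, hc hd hu hN hM, hR⟩, rfl⟩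

/-! ### Pieces and reductions -/

lemma reduction_apply (M : Matrix (Fin 2) (Fin 2) ℕ) (r c : Fin 2) :
    reduction M r c = (if M 0 0 ≤ M r c then 1 else 0) + (if M 0 1 ≤ M r c then 1 else 0) +
      ((if M 1 0 ≤ M r c then 1 else 0) + (if M 1 1 ≤ M r c then 1 else 0)) := by
  rw [reduction, card_filter, Fintype.sum_prod_type]
  simp only [Fin.sum_univ_two]

lemma reduction_congr {M M' : Matrix (Fin 2) (Fin 2) ℕ}
    (h : ∀ r c r' c', M r c ≤ M r' c' ↔ M' r c ≤ M' r' c') : reduction M = reduction M' := by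
  ext r c
  simp only [reduction_apply, h]

lemma lt_of_reduction_lt {M : Matrix (Fin 2) (Fin 2) ℕ} {r c r' c' : Fin 2}
    (h : reduction M r c < reduction M r' c') : M r c < M r' c' := by
  by_contra hle
  rw [not_lt] at hle
  exact absurd h (not_lt.2 (card_le_card fun q hq => by
    simp only [mem_filter] at hq ⊢
    exact ⟨hq.1, hq.2.trans hle⟩))

/-- Rotation of a matrix by a half-turn. -/
def rotate {n : ℕ} (α : Matrix (Fin 2) (Fin n) ℕ) : Matrix (Fin 2) (Fin n) ℕ :=
  α.submatrix Fin.rev Fin.rev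

lemma rotate_apply {n : ℕ} (α : Matrix (Fin 2) (Fin n) ℕ) (r : Fin 2) (c : Fin n) :
    rotate α r c = α r.rev c.rev := rfl

lemma rotate_rotate {n : ℕ} (α : Matrix (Fin 2) (Fin n) ℕ) : rotate (rotate α) = α := by
  ext r c
  simp only [rotate_apply, Fin.rev_rev]

lemma reduction_rotate (M : Matrix (Fin 2) (Fin 2) ℕ) :
    reduction (rotate M) = rotate (reduction M) := by
  ext r c
  simp only [rotate_apply, reduction_apply,
    show Fin.rev (0 : Fin 2) = 1 from rfl, show Fin.rev (1 : Fin 2) = 0 from rfl]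
  omega

/-- On labels, `F₁ ∘ F₂` is the half-turn. -/
lemma matrix_F₁_F₂ (c : StdPiece) : (F₁ (F₂ c)).matrix = rotate c.matrix := by
  have hA : ∀ i : ZMod 6, (F₁ (F₂ (.A i))).matrix = rotate (StdPiece.A i).matrix := by decide
  have hB : ∀ i : ZMod 6, (F₁ (F₂ (.B i))).matrix = rotate (StdPiece.B i).matrix := by decide
  have hC : ∀ i : ZMod 6, (F₁ (F₂ (.C i))).matrix = rotate (StdPiece.C i).matrix := by decide
  have hD : ∀ i : ZMod 6, (F₁ (F₂ (.D i))).matrix = rotate (StdPiece.D i).matrix := by decide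
  cases c with
  | A i => exact hA i
  | B i => exact hB i
  | C i => exact hC i
  | D i => exact hD i

/-- In a piece of type `A`, both columns decrease from top to bottom. -/
lemma lt_of_reduction_eq_A {M : Matrix (Fin 2) (Fin 2) ℕ} {i : ZMod 6}
    (h : reduction M = (StdPiece.A i).matrix) : M 1 0 < M 0 0 ∧ M 1 1 < M 0 1 := by
  have hA : ∀ i : ZMod 6, (StdPiece.A i).matrix 1 0 < (StdPiece.A i).matrix 0 0 ∧
      (StdPiece.A i).matrix 1 1 < (StdPiece.A i).matrix 0 1 := by decide
  have := hA i
  rw [← h] at this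
  exact ⟨lt_of_reduction_lt this.1, lt_of_reduction_lt this.2⟩

/-- The order of the labels of the `y`-th 1-converter, whose left column is `a < a'` and whose
right column is `b < b'` (from bottom to top on the left, from top to bottom on the right). -/
def converterOrder : ℕ → ℕ → ℕ → ℕ → ℕ → Prop
  | 1, a, a', b, b' => a < b ∧ b < b' ∧ b' < a'
  | 2, a, a', b, b' => a < b ∧ b < a' ∧ a' < b'
  | 3, a, a', b, b' => a < a' ∧ a' < b ∧ b < b'
  | 4, a, a', b, b' => b < a ∧ a < a' ∧ a' < b'
  | 5, a, a', b, b' => b < a ∧ a < b' ∧ b' < a'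
  | 6, a, a', b, b' => b < b' ∧ b' < a ∧ a < a'
  | _, _, _, _, _ => False

lemma converterOrder_lt {y a a' b b' : ℕ} (h : converterOrder y a a' b b') :
    a < a' ∧ b < b' := by
  unfold converterOrder at h
  split at h
  all_goals first | exact h.elim | omega

lemma reduction_eq_B_iff {M : Matrix (Fin 2) (Fin 2) ℕ} {y : ℕ} (hy : y ∈ Icc 1 6) :
    reduction M = (StdPiece.B (y : ZMod 6)).matrix ↔
      converterOrder y (M 1 0) (M 0 0) (M 0 1) (M 1 1) := by
  rw [mem_Icc] at hy
  obtain ⟨h1, h6⟩ := hy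
  constructor
  · intro h
    interval_cases y
    all_goals
      refine ⟨?_, ?_, ?_⟩ <;>
      · apply lt_of_reduction_lt
        rw [h]
        decide
  · intro h
    have key : ∀ y : ZMod 6, reduction (StdPiece.B y).matrix = (StdPiece.B y).matrix := by decide
    refine (reduction_congr ?_).trans (key _)
    simp only [Fin.forall_fin_two]
    interval_cases y
    all_goals
      simp only [converterOrder] at h
      simp +decide
      omega

/-- `P` is a support of the puzzle `α`. -/
def Supports {n : ℕ} (P : Set StdPiece) (α : Matrix (Fin 2) (Fin (n + 1)) ℕ) : Prop :=
  ∀ t : Fin n, ∃ c ∈ P, reduction (pieceAt α t) = c.matrix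

lemma pieceAt_rotate {n : ℕ} (α : Matrix (Fin 2) (Fin (n + 1)) ℕ) (t : Fin n) :
    pieceAt (rotate α) t = rotate (pieceAt α t.rev) := by
  ext r c
  fin_cases r <;> fin_cases c <;>
    simp [pieceAt, rotate_apply, Fin.rev_castSucc, Fin.rev_succ,
      show Fin.rev (0 : Fin 2) = 1 from rfl, show Fin.rev (1 : Fin 2) = 0 from rfl]

lemma rotate_injective {n : ℕ} : Function.Injective (rotate (n := n)) :=
  Function.LeftInverse.injective rotate_rotate

lemma reduction_eq_F_iff {M : Matrix (Fin 2) (Fin 2) ℕ} {P : Set StdPiece} :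
    (∃ c ∈ (F₁ ∘ F₂) '' P, reduction M = c.matrix) ↔
      ∃ c ∈ P, reduction (rotate M) = c.matrix := by
  rw [Set.exists_mem_image]
  simp only [Function.comp, matrix_F₁_F₂, reduction_rotate]
  constructor
  · rintro ⟨c, hc, h⟩
    exact ⟨c, hc, by rw [h, rotate_rotate]⟩
  · rintro ⟨c, hc, h⟩
    exact ⟨c, hc, by rw [← h, rotate_rotate]⟩

lemma supports_image_iff {n : ℕ} {P : Set StdPiece} {α : Matrix (Fin 2) (Fin (n + 1)) ℕ} :
    Supports ((F₁ ∘ F₂) '' P) α ↔ Supports P (rotate α) := by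
  simp only [Supports, reduction_eq_F_iff, pieceAt_rotate]
  exact ⟨fun h t => h t.rev, fun h t => by simpa using h t.rev⟩

lemma simplePiece_subset (x : ℕ) : simplePiece x ⊆ Set.range StdPiece.A := by
  intro c hc
  unfold simplePiece at hc
  split at hc
  all_goals
    simp only [Set.mem_insert_iff, Set.mem_singleton_iff, Set.mem_empty_iff_false] at hc <;>
    aesop

/-! ### Standardization -/

lemma isStandard_iff {n : ℕ} {α : Matrix (Fin 2) (Fin (n + 1)) ℕ} :
    IsStandard α ↔ Function.Injective (fun q : Fin 2 × Fin (n + 1) => α q.1 q.2) ∧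
      ∀ r c, α r c ∈ Icc 1 (2 * n + 2) := by
  constructor
  · intro h
    refine ⟨Set.injOn_univ.1 h.injOn, fun r c => ?_⟩
    have := h.mapsTo (Set.mem_univ (r, c))
    simpa using this
  · rintro ⟨hi, hm⟩
    have h := surjOn_of_injOn_of_card_le (s := univ) (t := Icc 1 (2 * n + 2))
      (fun q : Fin 2 × Fin (n + 1) => α q.1 q.2) (fun q _ => hm q.1 q.2) hi.injOn
      (by simp; omega)
    rw [coe_univ, coe_Icc] at h
    exact ⟨fun q _ => by simpa using hm q.1 q.2, hi.injOn, h⟩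

/-- The set of labels of a matrix. -/
def labels {n : ℕ} (U : Matrix (Fin 2) (Fin (n + 1)) ℕ) : Finset ℕ :=
  univ.image fun q : Fin 2 × Fin (n + 1) => U q.1 q.2

lemma mem_labels {n : ℕ} {U : Matrix (Fin 2) (Fin (n + 1)) ℕ} {t : ℕ} :
    t ∈ labels U ↔ ∃ r c, U r c = t := by
  simp [labels]

lemma card_labels {n : ℕ} {U : Matrix (Fin 2) (Fin (n + 1)) ℕ}
    (h : Function.Injective (fun q : Fin 2 × Fin (n + 1) => U q.1 q.2)) :
    (labels U).card = 2 * n + 2 := by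
  rw [labels, card_image_of_injective _ h]
  simp
  omega

/-- The matrix with label set `A` and the same relative order as the standard puzzle `β`. -/
noncomputable def relabel {n : ℕ} (A : Finset ℕ) (β : Matrix (Fin 2) (Fin (n + 1)) ℕ) :
    Matrix (Fin 2) (Fin (n + 1)) ℕ := β.map (element A)

section relabel

variable {n : ℕ} {A : Finset ℕ} {β : Matrix (Fin 2) (Fin (n + 1)) ℕ}

lemma one_le_and_le_card (hA : A.card = 2 * n + 2) (hβ : IsStandard β) (r : Fin 2)
    (c : Fin (n + 1)) : 1 ≤ β r c ∧ β r c ≤ A.card := by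
  have := (isStandard_iff.1 hβ).2 r c
  rw [mem_Icc] at this
  omega

lemma relabel_mem (hA : A.card = 2 * n + 2) (hβ : IsStandard β) (r : Fin 2) (c : Fin (n + 1)) :
    relabel A β r c ∈ A :=
  element_mem (one_le_and_le_card hA hβ r c).1 (one_le_and_le_card hA hβ r c).2

lemma rankIn_relabel (hA : A.card = 2 * n + 2) (hβ : IsStandard β) (r : Fin 2)
    (c : Fin (n + 1)) : rankIn A (relabel A β r c) = β r c :=
  rankIn_element (one_le_and_le_card hA hβ r c).1 (one_le_and_le_card hA hβ r c).2

lemma relabel_le_iff (hA : A.card = 2 * n + 2) (hβ : IsStandard β) (r : Fin 2)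
    (c : Fin (n + 1)) (r' : Fin 2) (c' : Fin (n + 1)) :
    relabel A β r c ≤ relabel A β r' c' ↔ β r c ≤ β r' c' := by
  rw [← rankIn_le_rankIn_iff (relabel_mem hA hβ r c), rankIn_relabel hA hβ, rankIn_relabel hA hβ]

lemma relabel_injective (hA : A.card = 2 * n + 2) (hβ : IsStandard β) :
    Function.Injective (fun q : Fin 2 × Fin (n + 1) => relabel A β q.1 q.2) := by
  intro q q' h
  refine (isStandard_iff.1 hβ).1 ?_
  simp only at h ⊢
  rw [← rankIn_relabel hA hβ q.1 q.2, h, rankIn_relabel hA hβ]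

lemma labels_relabel (hA : A.card = 2 * n + 2) (hβ : IsStandard β) :
    labels (relabel A β) = A := by
  refine eq_of_subset_of_card_le ?_ ?_
  · intro t ht
    obtain ⟨r, c, rfl⟩ := mem_labels.1 ht
    exact relabel_mem hA hβ r c
  · rw [card_labels (relabel_injective hA hβ), hA]

lemma reduction_eq_of_le_iff {U : Matrix (Fin 2) (Fin (n + 1)) ℕ}
    (h : ∀ r c r' c', U r c ≤ U r' c' ↔ β r c ≤ β r' c') (t : Fin n) :
    reduction (pieceAt U t) = reduction (pieceAt β t) := by
  refine reduction_congr ?_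
  simp [Fin.forall_fin_two, pieceAt, h]

lemma supports_relabel_iff (hA : A.card = 2 * n + 2) (hβ : IsStandard β) {P : Set StdPiece} :
    Supports P (relabel A β) ↔ Supports P β := by
  simp only [Supports, reduction_eq_of_le_iff (relabel_le_iff hA hβ)]

end relabel

/-- Every matrix with distinct labels is a relabelled standard puzzle. -/
lemma exists_isStandard_relabel {n : ℕ} {U : Matrix (Fin 2) (Fin (n + 1)) ℕ}
    (h : Function.Injective (fun q : Fin 2 × Fin (n + 1) => U q.1 q.2)) :
    ∃ β, IsStandard β ∧ relabel (labels U) β = U := by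
  have hU : ∀ r c, U r c ∈ labels U := fun r c => mem_labels.2 ⟨r, c, rfl⟩
  refine ⟨U.map (rankIn (labels U)), isStandard_iff.2 ⟨?_, ?_⟩, ?_⟩
  · intro q q' hq
    refine h ?_
    simp only [Matrix.map_apply] at hq ⊢
    rw [← element_rankIn (hU q.1 q.2), hq, element_rankIn (hU q'.1 q'.2)]
  · intro r c
    rw [mem_Icc, Matrix.map_apply, ← card_labels h]
    exact ⟨one_le_rankIn (hU r c), rankIn_le_card _ _⟩
  · ext r c
    exact element_rankIn (hU r c)

/-! ### Cutting a puzzle in two -/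

/-- The first `k + 1` columns. -/
def firstColumns {n k : ℕ} (h : k ≤ n) (α : Matrix (Fin 2) (Fin (n + 1)) ℕ) :
    Matrix (Fin 2) (Fin (k + 1)) ℕ := α.submatrix id (Fin.castLE (Nat.succ_le_succ h))

lemma pieceAt_firstColumns {n k : ℕ} (h : k ≤ n) (α : Matrix (Fin 2) (Fin (n + 1)) ℕ)
    (t : Fin k) : pieceAt (firstColumns h α) t = pieceAt α (Fin.castLE h t) := rfl

section join

variable {n k l : ℕ} (h : k + l + 1 = n)

/-- The matrix whose first `k + 1` columns are `U` and whose half-turn has the first `l + 1`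
columns `V`. -/
def join (U : Matrix (Fin 2) (Fin (k + 1)) ℕ)
    (V : Matrix (Fin 2) (Fin (l + 1)) ℕ) : Matrix (Fin 2) (Fin (n + 1)) ℕ := fun r c =>
  if hc : c.val < k + 1 then U r ⟨c, hc⟩ else V r.rev ⟨n - c, by omega⟩

include h in
/-- The first `k + 1` columns of a matrix and the first `l + 1` columns of its half-turn exhaust its
entries. -/
lemma forall_columns {R : Fin 2 → Fin (n + 1) → Prop} :
    (∀ r c, R r c) ↔ (∀ r (c : Fin (k + 1)), R r (Fin.castLE (by omega) c)) ∧
      ∀ r (c : Fin (l + 1)), R (Fin.rev r) (Fin.rev (Fin.castLE (by omega) c)) := by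
  constructor
  · exact fun H => ⟨fun r c => H _ _, fun r c => H _ _⟩
  · rintro ⟨H₁, H₂⟩ r c
    by_cases hc : c.val < k + 1
    · exact H₁ r ⟨c, hc⟩
    · have := H₂ r.rev ⟨n - c, by omega⟩
      rw [Fin.rev_rev] at this
      convert this using 1
      ext
      simp only [Fin.val_rev, Fin.val_castLE]
      omega

lemma firstColumns_join (U : Matrix (Fin 2) (Fin (k + 1)) ℕ) (V : Matrix (Fin 2) (Fin (l + 1)) ℕ) :
    firstColumns (k := k) (by omega) (join h U V) = U := by
  ext r c
  have hc : (Fin.castLE (show k + 1 ≤ n + 1 by omega) c).val < k + 1 := c.isLt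
  exact dif_pos hc

lemma firstColumns_rotate_join (U : Matrix (Fin 2) (Fin (k + 1)) ℕ)
    (V : Matrix (Fin 2) (Fin (l + 1)) ℕ) :
    firstColumns (k := l) (by omega) (rotate (join h U V)) = V := by
  ext r c
  have hc : ¬ (n + 1 - (c.val + 1) < k + 1) := by omega
  simp only [firstColumns, rotate_apply, join, Matrix.submatrix_apply, Fin.val_rev, Fin.val_castLE,
    id, Fin.rev_rev]
  rw [dif_neg hc]
  congr 1
  ext
  simp only
  omega

lemma join_firstColumns (α : Matrix (Fin 2) (Fin (n + 1)) ℕ) :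
    join h (firstColumns (k := k) (by omega) α) (firstColumns (k := l) (by omega) (rotate α)) = α := by
  ext r c
  revert r c
  rw [forall_columns h]
  constructor
  · intro r c
    exact congrFun (congrFun (firstColumns_join h (firstColumns (k := k) (by omega) α)
      (firstColumns (k := l) (by omega) (rotate α))) r) c
  · intro r c
    exact congrFun (congrFun (firstColumns_rotate_join h (firstColumns (k := k) (by omega) α)
      (firstColumns (k := l) (by omega) (rotate α))) r) c

end join

/-! ### Puzzles with one 1-converter -/

/-- Injectivity is automatic, because there are as many entries as labels. -/
lemma isStandard_iff_labels {n : ℕ} {α : Matrix (Fin 2) (Fin (n + 1)) ℕ} :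
    IsStandard α ↔ labels α = Icc 1 (2 * n + 2) := by
  constructor
  · intro h
    rw [← coe_inj, labels, coe_image, coe_univ, coe_Icc]
    exact h.image_eq
  · intro h
    refine isStandard_iff.2 ⟨?_, fun r c => h ▸ mem_labels.2 ⟨r, c, rfl⟩⟩
    have hc : (labels α).card = (univ : Finset (Fin 2 × Fin (n + 1))).card := by
      rw [h]
      simp
      omega
    simpa using card_image_iff.1 hc

section mixed

variable {n k l : ℕ} (h : k + l + 1 = n)

include h in
lemma labels_eq_union (α : Matrix (Fin 2) (Fin (n + 1)) ℕ) :
    labels α = labels (firstColumns (k := k) (by omega) α) ∪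
      labels (firstColumns (k := l) (by omega) (rotate α)) := by
  ext t
  have H := forall_columns h (R := fun r c => α r c ≠ t)
  rw [mem_union, mem_labels, mem_labels, mem_labels, ← not_iff_not, not_or]
  push Not
  exact H

include h in
/-- The piece across the cut. -/
lemma pieceAt_cut (α : Matrix (Fin 2) (Fin (n + 1)) ℕ) :
    pieceAt α ⟨k, by omega⟩ =
      !![firstColumns (k := k) (by omega) α 0 (Fin.last k),
        firstColumns (k := l) (by omega) (rotate α) 1 (Fin.last l);
        firstColumns (k := k) (by omega) α 1 (Fin.last k),
        firstColumns (k := l) (by omega) (rotate α) 0 (Fin.last l)] := by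
  have hr : (Fin.castLE (show l + 1 ≤ n + 1 by omega) (Fin.last l)).rev =
      Fin.succ ⟨k, by omega⟩ := by
    ext
    simp only [Fin.val_rev, Fin.val_castLE, Fin.val_last, Fin.val_succ]
    omega
  simp only [firstColumns, rotate_apply, Matrix.submatrix_apply, hr, id,
    show Fin.rev (0 : Fin 2) = 1 from rfl, show Fin.rev (1 : Fin 2) = 0 from rfl]
  rfl

/-- The standard `n`-puzzles whose piece in position `k` is the `y`-th 1-converter, with support `P`
to the left of it and, after a half-turn, support `Q` to the right of it. -/
def mixedPuzzles (P Q : Set StdPiece) (y : ℕ) : Set (Matrix (Fin 2) (Fin (n + 1)) ℕ) :=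
  {α | IsStandard α ∧ Supports P (firstColumns (k := k) (by omega) α) ∧
    Supports Q (firstColumns (k := l) (by omega) (rotate α)) ∧
    reduction (pieceAt α ⟨k, by omega⟩) = (StdPiece.B (y : ZMod 6)).matrix}

/-- The data that determine a mixed puzzle: how its labels are distributed to the two sides of the
1-converter, and the standardizations of the two sides. -/
def mixedData (n k l : ℕ) (P Q : Set StdPiece) (y : ℕ) :
    Set ((Finset ℕ × Finset ℕ) × Matrix (Fin 2) (Fin (k + 1)) ℕ ×
      Matrix (Fin 2) (Fin (l + 1)) ℕ) :=
  {d | d.1 ∈ partitions (2 * n + 2) (2 * k + 2) (fun a b =>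
      converterOrder y (a (d.2.1 1 (Fin.last k))) (a (d.2.1 0 (Fin.last k)))
        (b (d.2.2 1 (Fin.last l))) (b (d.2.2 0 (Fin.last l)))) ∧
    d.2.1 ∈ puzzles k P ∧ d.2.2 ∈ puzzles l Q}

include h in
lemma card_snd_of_mem_partitions {u : Finset ℕ × Finset ℕ} {R : (ℕ → ℕ) → (ℕ → ℕ) → Prop}
    (hu : u ∈ partitions (2 * n + 2) (2 * k + 2) R) : u.2.card = 2 * l + 2 := by
  have := card_union_of_disjoint hu.1
  rw [hu.2.1, hu.2.2.1, Nat.card_Icc] at this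
  omega

/-- Gluing the relabelled sides is a bijection from mixed data to mixed puzzles. -/
theorem ncard_mixedPuzzles (P Q : Set StdPiece) {y : ℕ} (hy : y ∈ Icc 1 6) :
    (mixedPuzzles h P Q y).ncard = (mixedData n k l P Q y).ncard := by
  symm
  refine Set.ncard_congr (fun d _ => join h (relabel d.1.1 d.2.1) (relabel d.1.2 d.2.2)) ?_ ?_ ?_
  · rintro ⟨⟨A, B⟩, β, γ⟩ ⟨hu, ⟨hβ, hP⟩, hγ, hQ⟩
    have hB := card_snd_of_mem_partitions h hu
    obtain ⟨-, hAB, hA, hR⟩ := hu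
    simp only at hβ hP hγ hQ hB hAB hA hR
    refine ⟨?_, ?_, ?_, ?_⟩
    · rw [isStandard_iff_labels, labels_eq_union h, firstColumns_join, firstColumns_rotate_join,
        labels_relabel hA hβ, labels_relabel hB hγ, hAB]
    · rw [firstColumns_join]
      exact (supports_relabel_iff hA hβ).2 hP
    · rw [firstColumns_rotate_join]
      exact (supports_relabel_iff hB hγ).2 hQ
    · rw [reduction_eq_B_iff hy, pieceAt_cut h, firstColumns_join, firstColumns_rotate_join]
      exact hR
  · rintro ⟨⟨A, B⟩, β, γ⟩ ⟨⟨A', B'⟩, β', γ'⟩ ⟨hu, ⟨hβ, -⟩, hγ, -⟩ ⟨hu', ⟨hβ', -⟩, hγ', -⟩ hd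
    have hB := card_snd_of_mem_partitions h hu
    have hB' := card_snd_of_mem_partitions h hu'
    have hA := hu.2.2.1
    have hA' := hu'.2.2.1
    simp only at hβ hγ hB hA hβ' hγ' hB' hA' hd
    have hU := firstColumns_join h (relabel A β) (relabel B γ)
    have hV := firstColumns_rotate_join h (relabel A β) (relabel B γ)
    rw [hd, firstColumns_join] at hU
    rw [hd, firstColumns_rotate_join] at hV
    have eA : A = A' := by rw [← labels_relabel hA hβ, ← hU, labels_relabel hA' hβ']
    have eB : B = B' := by rw [← labels_relabel hB hγ, ← hV, labels_relabel hB' hγ']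
    subst eA eB
    have eβ : β = β' := by
      ext r c
      rw [← rankIn_relabel hA hβ, ← hU, rankIn_relabel hA hβ']
    have eγ : γ = γ' := by
      ext r c
      rw [← rankIn_relabel hB hγ, ← hV, rankIn_relabel hB hγ']
    rw [eβ, eγ]
  · rintro α ⟨hα, hP, hQ, hR⟩
    have hinj := (isStandard_iff.1 hα).1
    set U := firstColumns (k := k) (by omega) α with hU
    set V := firstColumns (k := l) (by omega) (rotate α) with hV
    have hUi : Function.Injective (fun q : Fin 2 × Fin (k + 1) => U q.1 q.2) := by
      intro q q' hq
      have := @hinj (q.1, Fin.castLE (by omega) q.2) (q'.1, Fin.castLE (by omega) q'.2) hq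
      simpa [Prod.ext_iff] using this
    have hVi : Function.Injective (fun q : Fin 2 × Fin (l + 1) => V q.1 q.2) := by
      intro q q' hq
      have := @hinj (q.1.rev, (Fin.castLE (by omega) q.2).rev)
        (q'.1.rev, (Fin.castLE (by omega) q'.2).rev) hq
      simpa [Prod.ext_iff] using this
    have hl := labels_eq_union h α
    rw [isStandard_iff_labels.1 hα, ← hU, ← hV] at hl
    have cU := card_labels hUi
    have cV := card_labels hVi
    have hd : Disjoint (labels U) (labels V) := by
      rw [← card_union_eq_card_add_card, ← hl, Nat.card_Icc, cU, cV]
      omega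
    obtain ⟨β, hβ, eβ⟩ := exists_isStandard_relabel hUi
    obtain ⟨γ, hγ, eγ⟩ := exists_isStandard_relabel hVi
    refine ⟨⟨(labels U, labels V), β, γ⟩, ⟨⟨hd, hl.symm, cU, ?_⟩, ⟨hβ, ?_⟩, hγ, ?_⟩, ?_⟩
    · rw [reduction_eq_B_iff hy, pieceAt_cut h, ← hU, ← hV, ← eβ, ← eγ] at hR
      rw [eβ, eγ] at hR
      have e1 : ∀ r c, element (labels U) (β r c) = U r c := fun r c =>
        congrFun (congrFun eβ r) c
      have e2 : ∀ r c, element (labels V) (γ r c) = V r c := fun r c =>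
        congrFun (congrFun eγ r) c
      simp only [e1, e2]
      exact hR
    · exact (supports_relabel_iff cU hβ).1 (by rw [eβ]; exact hP)
    · exact (supports_relabel_iff cV hγ).1 (by rw [eγ]; exact hQ)
    · simp only [eβ, eγ]
      exact join_firstColumns h α

end mixed

/-! ### Summation over the labels at the cut -/

lemma finite_puzzles (n : ℕ) (P : Set StdPiece) : (puzzles n P).Finite := by
  have : (Set.pi Set.univ fun _ : Fin 2 => Set.pi Set.univ fun _ : Fin (n + 1) =>
      Set.Icc 1 (2 * n + 2)).Finite :=
    Set.Finite.pi fun _ => Set.Finite.pi fun _ => Set.finite_Icc _ _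
  refine this.subset fun α hα => ?_
  intro r _ c _
  have := (isStandard_iff.1 hα.1).2 r c
  simpa using this

lemma finite_partitions (N M : ℕ) (R : (ℕ → ℕ) → (ℕ → ℕ) → Prop) :
    (partitions N M R).Finite := by
  refine ((Icc 1 N).powerset ×ˢ (Icc 1 N).powerset).finite_toSet.subset ?_
  rintro u ⟨-, hu, -, -⟩
  rw [mem_coe, mem_product, mem_powerset, mem_powerset, ← hu]
  exact ⟨subset_union_left, subset_union_right⟩

lemma finite_mixedData (n k l : ℕ) (P Q : Set StdPiece) (y : ℕ) :
    (mixedData n k l P Q y).Finite := by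
  refine ((finite_partitions (2 * n + 2) (2 * k + 2) fun _ _ => True).prod
    ((finite_puzzles k P).prod (finite_puzzles l Q))).subset ?_
  rintro d ⟨hu, hP, hQ⟩
  exact ⟨⟨hu.1, hu.2.1, hu.2.2.1, trivial⟩, hP, hQ⟩

lemma ncard_eq_sum_ncard_fiber {α ι : Type*} {s : Set α} (hs : s.Finite) {f : α → ι}
    {t : Finset ι} (hf : ∀ a ∈ s, f a ∈ t) : s.ncard = ∑ b ∈ t, {a ∈ s | f a = b}.ncard := by
  classical
  rw [Set.ncard_eq_toFinset_card s hs, card_eq_sum_card_fiberwise (f := f) (t := t)]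
  · refine sum_congr rfl fun b _ => ?_
    rw [← Set.ncard_coe_finset]
    congr 1
    ext a
    simp
  · intro a ha
    exact hf a (by simpa using ha)

/-- The kernels of `B₄, B₅, B₆` are those of `B₁, B₂, B₃` with the two parts exchanged. -/
lemma T_eq_ncard {y i j k l m p : ℕ} (hy : y ∈ Icc 1 6) (h : Admissible i j k l m p) :
    T y i j k l m p = (partitions (2 * m + 2 * p) (2 * m) fun a b =>
      converterOrder y (a i) (a (i + j)) (b k) (b (k + l))).ncard := by
  have h' : Admissible k l i j p m :=
    ⟨h.k_pos, h.l_pos, h.i_pos, h.j_pos, h.right, h.left⟩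
  have e : 2 * p + 2 * m = 2 * m + 2 * p := add_comm _ _
  rw [mem_Icc] at hy
  obtain ⟨h1, h6⟩ := hy
  interval_cases y
  · exact Q₁_eq_ncard h
  · exact Q₂_eq_ncard h
  · exact Q₃_eq_ncard h
  · exact (Q₁_eq_ncard h').trans (by rw [e, partitions_swap _ (2 * m) (2 * p) rfl]; rfl)
  · exact (Q₂_eq_ncard h').trans (by rw [e, partitions_swap _ (2 * m) (2 * p) rfl]; rfl)
  · exact (Q₃_eq_ncard h').trans (by rw [e, partitions_swap _ (2 * m) (2 * p) rfl]; rfl)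

/-- The standard `k`-puzzles with support `P` whose rightmost column has `i` at the bottom and
`i + j` at the top. -/
def endPuzzles (P : Set StdPiece) (i j k : ℕ) :
    Set (Matrix (Fin 2) (Fin (k + 1)) ℕ) :=
  {α ∈ puzzles k P | α 1 (Fin.last k) = i ∧ α 0 (Fin.last k) = i + j}

lemma mem_posPairs {N i j : ℕ} : (i, j) ∈ posPairs N ↔ 1 ≤ i ∧ 1 ≤ j ∧ i + j ≤ N := by
  simp only [posPairs, mem_filter, mem_product, mem_Icc]
  omega

/-- Once the labels `i, i + j` and `k, k + l` at the cut are fixed, the three components of the data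
are independent. -/
theorem ncard_mixedData {n k l : ℕ} (h : k + l + 1 = n) (P Q : Set StdPiece) {y : ℕ}
    (hy : y ∈ Icc 1 6) :
    (mixedData n k l P Q y).ncard =
      ∑ u ∈ posPairs (2 * (k + 1)), ∑ v ∈ posPairs (2 * (l + 1)),
        (endPuzzles P u.1 u.2 k).ncard * T y u.1 u.2 v.1 v.2 (k + 1) (l + 1) *
          (endPuzzles Q v.1 v.2 l).ncard := by
  rw [← sum_product', ncard_eq_sum_ncard_fiber (finite_mixedData n k l P Q y)
    (t := posPairs (2 * (k + 1)) ×ˢ posPairs (2 * (l + 1)))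
    (f := fun d =>
      ((d.2.1 1 (Fin.last k), d.2.1 0 (Fin.last k) - d.2.1 1 (Fin.last k)),
        (d.2.2 1 (Fin.last l), d.2.2 0 (Fin.last l) - d.2.2 1 (Fin.last l))))]
  · refine sum_congr rfl ?_
    rintro ⟨⟨i, j⟩, ⟨i', j'⟩⟩ huv
    rw [mem_product, mem_posPairs, mem_posPairs] at huv
    obtain ⟨⟨hi, hj, hij⟩, hi', hj', hij'⟩ := huv
    simp only at hi hj hij hi' hj' hij' ⊢
    rw [T_eq_ncard hy ⟨hi, hj, hi', hj', hij, hij'⟩,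
      show 2 * (k + 1) + 2 * (l + 1) = 2 * n + 2 by omega, show 2 * (k + 1) = 2 * k + 2 by ring,
      mul_comm (endPuzzles P i j k).ncard, mul_assoc, ← Set.ncard_prod, ← Set.ncard_prod]
    congr 1
    ext ⟨u, β, γ⟩
    simp only [mixedData, endPuzzles, Set.mem_ofPred_eq, Set.mem_prod, Prod.mk.injEq]
    constructor
    · rintro ⟨⟨hu, hβ, hγ⟩, ⟨e1, e2⟩, e3, e4⟩
      have e5 : β 0 (Fin.last k) = i + j := by omega
      have e6 : γ 0 (Fin.last l) = i' + j' := by omega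
      rw [e1, e3, e5, e6] at hu
      exact ⟨hu, ⟨hβ, e1, e5⟩, hγ, e3, e6⟩
    · rintro ⟨hu, ⟨hβ, e1, e2⟩, hγ, e3, e4⟩
      rw [e1, e2, e3, e4]
      exact ⟨⟨hu, hβ, hγ⟩, ⟨rfl, by omega⟩, rfl, by omega⟩
  · rintro ⟨⟨A, B⟩, β, γ⟩ ⟨hu, ⟨hβ, -⟩, hγ, -⟩
    have hB := card_snd_of_mem_partitions h hu
    obtain ⟨-, -, hA, hR⟩ := hu
    simp only at hβ hγ hB hA hR
    -- The order of the 1-converter forces `j, l ≥ 1`, also for a side with one column only.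
    have hlt := converterOrder_lt hR
    have b1 := one_le_and_le_card hA hβ 1 (Fin.last k)
    have b0 := one_le_and_le_card hA hβ 0 (Fin.last k)
    have c1 := one_le_and_le_card hB hγ 1 (Fin.last l)
    have c0 := one_le_and_le_card hB hγ 0 (Fin.last l)
    rw [element_lt_element_iff b1.1 b1.2 b0.1 b0.2,
      element_lt_element_iff c1.1 c1.2 c0.1 c0.2] at hlt
    simp only [mem_product, mem_posPairs]
    omega

/-! ### The decomposition by the number of decreasing columns -/

/-- The number of columns of `α` whose top label exceeds the bottom label. -/
def descents {n : ℕ} (α : Matrix (Fin 2) (Fin (n + 1)) ℕ) : ℕ :=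
  (univ.filter fun c : Fin (n + 1) => α 1 c < α 0 c).card

section descents

variable {n y : ℕ} {P Q : Set StdPiece} {α : Matrix (Fin 2) (Fin (n + 1)) ℕ}

lemma lt_of_mem_left (hP : P ⊆ Set.range StdPiece.A) {t : Fin n}
    (h : ∃ c ∈ P, reduction (pieceAt α t) = c.matrix) :
    α 1 t.castSucc < α 0 t.castSucc ∧ α 1 t.succ < α 0 t.succ := by
  obtain ⟨c, hc, h⟩ := h
  obtain ⟨i, rfl⟩ := hP hc
  exact lt_of_reduction_eq_A h

lemma lt_of_mem_right (hQ : Q ⊆ Set.range StdPiece.A) {t : Fin n}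
    (h : ∃ c ∈ (F₁ ∘ F₂) '' Q, reduction (pieceAt α t) = c.matrix) :
    α 0 t.castSucc < α 1 t.castSucc ∧ α 0 t.succ < α 1 t.succ := by
  obtain ⟨c, hc, h⟩ := reduction_eq_F_iff.1 h
  obtain ⟨i, rfl⟩ := hQ hc
  exact (lt_of_reduction_eq_A h).symm

lemma lt_of_eq_B (hy : y ∈ Icc 1 6) {t : Fin n}
    (h : reduction (pieceAt α t) = (StdPiece.B (y : ZMod 6)).matrix) :
    α 1 t.castSucc < α 0 t.castSucc ∧ α 0 t.succ < α 1 t.succ :=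
  converterOrder_lt ((reduction_eq_B_iff hy).1 h)

lemma exists_mem_union_iff {M : Matrix (Fin 2) (Fin 2) ℕ} :
    (∃ c ∈ P ∪ {StdPiece.B (y : ZMod 6)} ∪ (F₁ ∘ F₂) '' Q, M = c.matrix) ↔
      (∃ c ∈ P, M = c.matrix) ∨ M = (StdPiece.B (y : ZMod 6)).matrix ∨
        ∃ c ∈ (F₁ ∘ F₂) '' Q, M = c.matrix := by
  simp only [Set.mem_union, Set.mem_singleton_iff, or_and_right, exists_or, exists_eq_left,
    or_assoc]

/-- Once the columns of a puzzle have begun to increase, they increase to the end. -/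
lemma lt_iff_lt_descents (hP : P ⊆ Set.range StdPiece.A) (hQ : Q ⊆ Set.range StdPiece.A)
    (hy : y ∈ Icc 1 6) (h : Supports (P ∪ {StdPiece.B (y : ZMod 6)} ∪ (F₁ ∘ F₂) '' Q) α)
    (c : Fin (n + 1)) : α 1 c < α 0 c ↔ c.val < descents α := by
  have hanti : Antitone fun c => α 1 c < α 0 c := by
    rw [Fin.antitone_iff_succ_le]
    intro t ht
    rcases exists_mem_union_iff.1 (h t) with h | h | h
    · exact (lt_of_mem_left hP h).1
    · exact (lt_of_eq_B hy h).1
    · exact absurd ht (lt_of_mem_right hQ h).2.not_gt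
  constructor
  · intro hc
    have : Iic c ⊆ univ.filter fun c : Fin (n + 1) => α 1 c < α 0 c := fun c' hc' =>
      mem_filter.2 ⟨mem_univ _, hanti (mem_Iic.1 hc') hc⟩
    have := card_le_card this
    rw [Fin.card_Iic] at this
    exact this
  · intro hc
    by_contra hlt
    have : (univ.filter fun c : Fin (n + 1) => α 1 c < α 0 c) ⊆ Iio c := fun c' hc' => by
      rw [mem_Iio]
      by_contra hle
      exact hlt (hanti (not_lt.1 hle) (mem_filter.1 hc').2)
    have := card_le_card this
    rw [Fin.card_Iio] at this
    exact absurd hc (not_lt.2 this)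

lemma descents_le : descents α ≤ n + 1 := by
  have := card_filter_le (univ : Finset (Fin (n + 1))) fun c => α 1 c < α 0 c
  rwa [card_univ, Fintype.card_fin] at this

/-- All columns decrease exactly when all pieces are of type `A`. -/
lemma puzzles_descents_last (hn : 1 ≤ n) (hP : P ⊆ Set.range StdPiece.A)
    (hQ : Q ⊆ Set.range StdPiece.A) (hy : y ∈ Icc 1 6) :
    {α ∈ puzzles n (P ∪ {StdPiece.B (y : ZMod 6)} ∪ (F₁ ∘ F₂) '' Q) | descents α = n + 1} =
      puzzles n P := by
  ext α
  constructor
  · rintro ⟨⟨hα, hs⟩, hd⟩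
    refine ⟨hα, fun t => ?_⟩
    have ht := (lt_iff_lt_descents hP hQ hy hs t.succ).2 (by rw [hd]; exact t.succ.isLt)
    rcases exists_mem_union_iff.1 (hs t) with h | h | h
    · exact h
    · exact absurd ht (lt_of_eq_B hy h).2.not_gt
    · exact absurd ht (lt_of_mem_right hQ h).2.not_gt
  · rintro ⟨hα, hs⟩
    have hs' : Supports (P ∪ {StdPiece.B (y : ZMod 6)} ∪ (F₁ ∘ F₂) '' Q) α := fun t =>
      exists_mem_union_iff.2 (Or.inl (hs t))
    have hlast := (lt_of_mem_left hP (hs ⟨n - 1, by omega⟩)).2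
    have := (lt_iff_lt_descents hP hQ hy hs' _).1 hlast
    have hle := descents_le (α := α)
    simp only [Fin.val_succ] at this
    exact ⟨⟨hα, hs'⟩, by omega⟩

/-- No column decreases exactly when all pieces are of type `D`. -/
lemma puzzles_descents_zero (hn : 1 ≤ n) (hP : P ⊆ Set.range StdPiece.A)
    (hQ : Q ⊆ Set.range StdPiece.A) (hy : y ∈ Icc 1 6) :
    {α ∈ puzzles n (P ∪ {StdPiece.B (y : ZMod 6)} ∪ (F₁ ∘ F₂) '' Q) | descents α = 0} =
      puzzles n ((F₁ ∘ F₂) '' Q) := by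
  ext α
  constructor
  · rintro ⟨⟨hα, hs⟩, hd⟩
    refine ⟨hα, fun t => ?_⟩
    have ht := (lt_iff_lt_descents hP hQ hy hs t.castSucc).not.2 (by rw [hd]; exact not_lt_zero)
    rcases exists_mem_union_iff.1 (hs t) with h | h | h
    · exact absurd (lt_of_mem_left hP h).1 ht
    · exact absurd (lt_of_eq_B hy h).1 ht
    · exact h
  · rintro ⟨hα, hs⟩
    have hs' : Supports (P ∪ {StdPiece.B (y : ZMod 6)} ∪ (F₁ ∘ F₂) '' Q) α := fun t =>
      exists_mem_union_iff.2 (Or.inr (Or.inr (hs t)))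
    have hfirst := (lt_of_mem_right hQ (hs ⟨0, by omega⟩)).1.not_gt
    have := (lt_iff_lt_descents hP hQ hy hs' _).not.1 hfirst
    simp only [Fin.val_castSucc] at this
    exact ⟨⟨hα, hs'⟩, by omega⟩

/-- If some but not all columns decrease, the 1-converter is the piece between the last decreasing
and the first increasing column. -/
lemma puzzles_descents_succ {k l : ℕ} (h : k + l + 1 = n) (hP : P ⊆ Set.range StdPiece.A)
    (hQ : Q ⊆ Set.range StdPiece.A) (hy : y ∈ Icc 1 6) :
    {α ∈ puzzles n (P ∪ {StdPiece.B (y : ZMod 6)} ∪ (F₁ ∘ F₂) '' Q) | descents α = k + 1} =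
      mixedPuzzles h P Q y := by
  ext α
  constructor
  · rintro ⟨⟨hα, hs⟩, hd⟩
    have hlt := lt_iff_lt_descents hP hQ hy hs
    rw [hd] at hlt
    refine ⟨hα, fun t => ?_, fun t => ?_, ?_⟩
    · rw [pieceAt_firstColumns]
      set t' := Fin.castLE (show k ≤ n by omega) t with ht'
      have ht := (hlt t'.succ).2 (by
        rw [Fin.val_succ, ht', Fin.val_castLE]
        omega)
      rcases exists_mem_union_iff.1 (hs t') with h | h | h
      · exact h
      · exact absurd ht (lt_of_eq_B hy h).2.not_gt
      · exact absurd ht (lt_of_mem_right hQ h).2.not_gt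
    · rw [pieceAt_firstColumns, pieceAt_rotate]
      set t' := (Fin.castLE (show l ≤ n by omega) t).rev with ht'
      have ht := (hlt t'.castSucc).not.2 (by
        rw [Fin.val_castSucc, ht', Fin.val_rev, Fin.val_castLE]
        omega)
      rcases exists_mem_union_iff.1 (hs t') with h | h | h
      · exact absurd (lt_of_mem_left hP h).1 ht
      · exact absurd (lt_of_eq_B hy h).1 ht
      · exact reduction_eq_F_iff.1 h
    · have h1 := (hlt (Fin.castSucc ⟨k, by omega⟩)).2 (by simp)
      have h2 := (hlt (Fin.succ ⟨k, by omega⟩)).not.2 (by simp)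
      rcases exists_mem_union_iff.1 (hs ⟨k, by omega⟩) with h | h | h
      · exact absurd (lt_of_mem_left hP h).2 h2
      · exact h
      · exact absurd h1 (lt_of_mem_right hQ h).1.not_gt
  · rintro ⟨hα, hsP, hsQ, hB⟩
    have hs : Supports (P ∪ {StdPiece.B (y : ZMod 6)} ∪ (F₁ ∘ F₂) '' Q) α := by
      intro t
      rw [exists_mem_union_iff]
      rcases lt_trichotomy t.val k with ht | ht | ht
      · exact Or.inl (hsP ⟨t, ht⟩)
      · have ht' : t = ⟨k, by omega⟩ := Fin.ext ht
        exact Or.inr (Or.inl (ht' ▸ hB))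
      · refine Or.inr (Or.inr (reduction_eq_F_iff.2 ?_))
        have := hsQ ⟨n - (t.val + 1), by omega⟩
        have ht' : (Fin.castLE (show l ≤ n by omega) ⟨n - (t.val + 1), by omega⟩).rev = t := by
          ext
          simp only [Fin.val_rev, Fin.val_castLE]
          omega
        rwa [pieceAt_firstColumns, pieceAt_rotate, ht'] at this
    have hlt := lt_iff_lt_descents hP hQ hy hs
    have h1 := (hlt _).1 (lt_of_eq_B hy hB).1
    have h2 := (hlt _).not.1 (lt_of_eq_B hy hB).2.not_gt
    simp only [Fin.val_castSucc, Fin.val_succ] at h1 h2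
    exact ⟨⟨hα, hs⟩, by omega⟩

end descents

lemma isStandard_rotate {n : ℕ} {α : Matrix (Fin 2) (Fin (n + 1)) ℕ} (h : IsStandard α) :
    IsStandard (rotate α) := by
  rw [isStandard_iff] at h ⊢
  refine ⟨fun q q' hq => ?_, fun r c => h.2 _ _⟩
  have := @h.1 (q.1.rev, q.2.rev) (q'.1.rev, q'.2.rev) hq
  simpa [Prod.ext_iff] using this

/-- The half-turn turns the support `F₁ ∘ F₂ (Q)` into `Q`. -/
lemma numPuzzles_image (n : ℕ) (Q : Set StdPiece) :
    numPuzzles n ((F₁ ∘ F₂) '' Q) = numPuzzles n Q := by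
  refine Set.ncard_congr (fun α _ => rotate α) ?_ ?_ ?_
  · exact fun α hα => ⟨isStandard_rotate hα.1, supports_image_iff.1 hα.2⟩
  · exact fun α α' _ _ h => rotate_injective h
  · refine fun α hα => ⟨rotate α, ⟨isStandard_rotate hα.1, ?_⟩, rotate_rotate α⟩
    refine supports_image_iff.2 ?_
    rw [rotate_rotate]
    exact hα.2

lemma sum_splittings (n : ℕ) (g : ℕ × ℕ → ℕ) :
    ∑ mp ∈ splittings (n + 1), g mp = ∑ k ∈ range n, g (k + 1, n - k) := by
  refine sum_nbij' (fun mp => mp.1 - 1) (fun k => (k + 1, n - k)) ?_ ?_ ?_ ?_ ?_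
  · rintro ⟨m, p⟩ h
    simp only [splittings, mem_filter, HasAntidiagonal.mem_antidiagonal, mem_range] at *
    omega
  · intro k h
    simp only [splittings, mem_filter, HasAntidiagonal.mem_antidiagonal, mem_range] at *
    omega
  · rintro ⟨m, p⟩ h
    simp only [splittings, mem_filter, HasAntidiagonal.mem_antidiagonal, Prod.mk.injEq] at *
    omega
  · intro k _
    simp
  · rintro ⟨m, p⟩ h
    simp only [splittings, mem_filter, HasAntidiagonal.mem_antidiagonal] at h
    congr 1
    simp only [Prod.mk.injEq]
    omega

/-- The decomposition formula for any two supports of type `A`. -/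
theorem numPuzzles_union {n : ℕ} (hn : 1 ≤ n) {P Q : Set StdPiece}
    (hP : P ⊆ Set.range StdPiece.A) (hQ : Q ⊆ Set.range StdPiece.A) {y : ℕ}
    (hy : y ∈ Icc 1 6) :
    numPuzzles n (P ∪ {StdPiece.B (y : ZMod 6)} ∪ (F₁ ∘ F₂) '' Q) =
      (∑ mp ∈ splittings (n + 1), ∑ u ∈ posPairs (2 * mp.1), ∑ v ∈ posPairs (2 * mp.2),
        (endPuzzles P u.1 u.2 (mp.1 - 1)).ncard * T y u.1 u.2 v.1 v.2 mp.1 mp.2 *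
          (endPuzzles Q v.1 v.2 (mp.2 - 1)).ncard) +
      numPuzzles n P + numPuzzles n Q := by
  rw [numPuzzles, ncard_eq_sum_ncard_fiber (finite_puzzles n _) (f := descents)
    (t := range (n + 1 + 1)) fun α _ => mem_range.2 (Nat.lt_succ_of_le descents_le),
    sum_range_succ, sum_range_succ', puzzles_descents_last hn hP hQ hy,
    puzzles_descents_zero hn hP hQ hy, ← numPuzzles, ← numPuzzles, numPuzzles_image,
    sum_splittings, add_right_comm]
  congr 2
  refine sum_congr rfl fun k hk => ?_
  rw [mem_range] at hk
  obtain ⟨l, hl⟩ : ∃ l, k + l + 1 = n := ⟨n - k - 1, by omega⟩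
  rw [puzzles_descents_succ hl hP hQ hy, ncard_mixedPuzzles hl P Q hy, ncard_mixedData hl P Q hy,
    show n - k = l + 1 by omega]
  rfl

end StandardPuzzle

theorem mainTheorem7 (n : ℕ) (hn : 1 ≤ n) (x y z : ℕ)
    (hx : x ∈ Finset.Icc 1 20) (hy : y ∈ Finset.Icc 1 6) (hz : z ∈ Finset.Icc 1 20) :
    numPuzzles n (simplePiece x ∪ {StdPiece.B (y : ZMod 6)} ∪ (F₁ ∘ F₂) '' simplePiece z) =
      (∑ mp ∈ splittings (n + 1), ∑ ij ∈ posPairs (2 * mp.1), ∑ kl ∈ posPairs (2 * mp.2),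
        endCount x ij.1 ij.2 mp.1 * T y ij.1 ij.2 kl.1 kl.2 mp.1 mp.2 *
          endCount z kl.1 kl.2 mp.2) +
      numPuzzles n (simplePiece x) + numPuzzles n (simplePiece z) ∧
    ∀ mp ∈ splittings (n + 1), ∀ ij ∈ posPairs (2 * mp.1), ∀ kl ∈ posPairs (2 * mp.2),
      Q₁ ij.1 ij.2 kl.1 kl.2 mp.1 mp.2 = (partitions (2 * n + 2) (2 * mp.1) fun a b =>
          a ij.1 < b kl.1 ∧ b kl.1 < b (kl.1 + kl.2) ∧
            b (kl.1 + kl.2) < a (ij.1 + ij.2)).ncard ∧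
      Q₂ ij.1 ij.2 kl.1 kl.2 mp.1 mp.2 = (partitions (2 * n + 2) (2 * mp.1) fun a b =>
          a ij.1 < b kl.1 ∧ b kl.1 < a (ij.1 + ij.2) ∧
            a (ij.1 + ij.2) < b (kl.1 + kl.2)).ncard ∧
      Q₃ ij.1 ij.2 kl.1 kl.2 mp.1 mp.2 = (partitions (2 * n + 2) (2 * mp.1) fun a b =>
          a ij.1 < a (ij.1 + ij.2) ∧ a (ij.1 + ij.2) < b kl.1 ∧
            b kl.1 < b (kl.1 + kl.2)).ncard := by
  refine ⟨numPuzzles_union hn (simplePiece_subset x) (simplePiece_subset z) hy, ?_⟩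
  rintro ⟨m, p⟩ hmp ⟨i, j⟩ hij ⟨k, l⟩ hkl
  simp only [splittings, Finset.mem_filter, Finset.HasAntidiagonal.mem_antidiagonal] at hmp
  obtain ⟨hi, hj, hij⟩ := mem_posPairs.1 hij
  obtain ⟨hk, hl, hkl⟩ := mem_posPairs.1 hkl
  have h : Admissible i j k l m p := ⟨hi, hj, hk, hl, hij, hkl⟩
  rw [show 2 * n + 2 = 2 * m + 2 * p by omega]
  exact ⟨Q₁_eq_ncard h, Q₂_eq_ncard h, Q₃_eq_ncard h⟩
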